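/- **General consistency (for an out-of-order, speculative machine).** *Machine.* Fix a set of register names with a dedicated stack pointer register $r_{sp}$ and a temporary register $r_{ret}$, a set $\mathcal V$ of values, a lattice of security labels with least element (public), and arbitrary partial evaluation functions for opcodes, branch conditions and addresses/jump targets. A configuration is $C=(\rho,\mu,n,buf)$: a partial register map $\rho$ to labelled values, a memory $\mu$ mapping each address to an instruction, to a labelled datum, or to nothing, a program point $n\in\mathcal V$, and a reorder buffer $buf:\mathbb N\rightharpoonup \text{TransInstr}$. Executions carry in addition a return stack buffer $\sigma$, an indexed sequence of push/pop commands used only for predicting return targets. Instructions are: operation, conditional branch, load, store, indirect jump, direct call, return, fence. A schedule is a list $D$ of attacker directives, each of which triggers one step of one of three kinds (in each case only if the step is enabled): * *Fetch* places the transient form of $\mu(n)$ at the fresh index $\max(\mathrm{dom}\,buf)+1$ (with $\max\emptyset=0$) and moves $n$ to the next point; for a branch, for an indirect jump, and for a return when the stack given by $\sigma$ is empty, the next point is guessed by the directive. Otherwise a return is predicted to go to the top of that stack. A call is fetched as a block of three entries (call marker, $r_{sp}=succ(r_{sp})$, store of the return address at $[r_{sp}]$) and is recorded in $\sigma$ as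 a push; a return is fetched as a block of four (return marker, load of $r_{ret}$ from $[r_{sp}]$, $r_{sp}=pred(r_{sp})$, indirect jump to $[r_{ret}]$) and is recorded as a pop. * *Execute $i$* resolves the entry at index $i$, provided no fence is pending before $i$. A register operand has the value of its latest assignment before $i$ in $buf$, is undefined if that assignment has no value yet, and has the value in $\rho$ if there is no such assignment. A store resolves its value and its address separately. A load takes its value from the latest earlier store in $buf$ whose address is resolved to the load's address, and from $\mu$ if there is none; alternatively the directive may guess that it aliases an earlier store with resolved value, whose value it then forwards provisionally until the load's own address is checked. A wrong guess of a branch or jump removes all later entries and resumes at the correct target. A load found, when its own address is checked or when the address of an earlier store is resolved, to have used the wrong store or stale memory is removed with all later entries (a return's load together with its return marker), and execution resumes at the load's program point. In all these cases $\sigma$ is rolled back to the same index. * *Retire* commits the oldest entry, when fully resolved, to $\rho$ or $\mu$ and removes it; the block of a call or a return is retired as a whole by one directive, which commits $r_{sp}$ (and, for a call, the stored return address) but not $r_{ret}$. A store is retired only to an address that does not hold an instruction. Write $C\Downarrow^{N}_{D}C'$ if executing the schedule $D$ from $C$ is possible and leads to $C'$, where $N$ is the number of retired instructions, i.e. of retire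 directives in $D$. Call $C$ *initial* (or *terminal*) if its reorder buffer is empty. Write $C_1\approx C_2$ if $C_1$ and $C_2$ have the same memory and the same register map. *Statement.* Let $C$ be an initial configuration (with any return stack buffer) such that no instruction in its memory names $r_{ret}$ as an operand. Let $N\in\mathbb N$ and let $D_1,D_2$ be arbitrary schedules. If $C\Downarrow^{N}_{D_1}C_1$ and $C\Downarrow^{N}_{D_2}C_2$ (both executions retire the same number $N$ of instructions), then $C_1\approx C_2$. Furthermore, if $C_1$ and $C_2$ are both terminal, then $C_1=C_2$ as configurations $(\rho,\mu,n,buf)$. -/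

import Mathlib

namespace SpecMachine

/-! ### Values, instructions, transient instructions -/

/-- A value `v_ℓ` annotated with a security label. -/
structure LVal (V L : Type*) where
  val : V
  lab : L

/-- An operand `rv`: a register name or a (labelled) value. -/
inductive Operand (R V L : Type*) where
  | reg (r : R)
  | val (v : LVal V L)

/-- Physical instructions, as they are stored in memory.  `n'` is the next program point. -/
inductive Instr (R V L Op : Type*) where
  | op (o : Op) (r : R) (rvs : List (Operand R V L)) (n' : V)
  | br (o : Op) (rvs : List (Operand R V L)) (nT nF : V)
  | load (r : R) (rvs : List (Operand R V L)) (n' : V)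
  | store (rv : Operand R V L) (rvs : List (Operand R V L)) (n' : V)
  | jmpi (rvs : List (Operand R V L))
  | call (nf nret : V)
  | ret
  | fence (n' : V)

/-- The operands (register names or values) that the text of a physical instruction reads. -/
def Instr.operands {R V L Op : Type*} : Instr R V L Op → List (Operand R V L)
  | .op _ _ rvs _ => rvs
  | .br _ rvs _ _ => rvs
  | .load _ rvs _ => rvs
  | .store rv rvs _ => rv :: rvs
  | .jmpi rvs => rvs
  | .call _ _ => []
  | .ret => []
  | .fence _ => []

/-- The address part of a transient store: still unresolved operands, or a resolved `a_ℓ`. -/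
inductive StoreAddr (R V L : Type*) where
  | args (rvs : List (Operand R V L))
  | resolved (a : V) (l : L)

/-- Transient instructions, the entries of the reorder buffer. -/
inductive TransInstr (R V L Op : Type*) where
  /-- `r = op(o, rvs)`: unresolved operation -/
  | op (o : Op) (r : R) (rvs : List (Operand R V L))
  /-- `r = v_ℓ`: resolved operation -/
  | val (r : R) (v : LVal V L)
  /-- `br(o, rvs, n₀, (nT, nF))`: unresolved branch, predicted to go to `n₀` -/
  | br (o : Op) (rvs : List (Operand R V L)) (n₀ nT nF : V)
  /-- `jump n₀`: resolved branch or resolved indirect jump -/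
  | jump (n₀ : V)
  /-- `(r = load(rvs))ⁿ`: unresolved load, fetched at program point `n` -/
  | load (r : R) (rvs : List (Operand R V L)) (n : V)
  /-- `(r = load(rvs, (v_ℓ, j)))ⁿ`: load predicted to receive `v_ℓ` from the store at `j` -/
  | loadGuess (r : R) (rvs : List (Operand R V L)) (v : LVal V L) (j : ℕ) (n : V)
  /-- `(r = v_ℓ{dep, a})ⁿ`: load resolved to address `a`; the value was forwarded from the store
  at index `dep`, or read from memory if `dep = ⊥` -/
  | loadVal (r : R) (v : LVal V L) (dep : WithBot ℕ) (a : V) (n : V)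
  /-- `store(rv, rvs)`, with value and address resolved independently of each other -/
  | store (rv : Operand R V L) (ad : StoreAddr R V L)
  /-- `jmpi(rvs, n₀)`: indirect jump predicted to go to `n₀` -/
  | jmpi (rvs : List (Operand R V L)) (n₀ : V)
  | call
  | ret
  | fence

/-- The register that a transient instruction assigns: the instructions `r = _`. -/
def TransInstr.dest {R V L Op : Type*} : TransInstr R V L Op → Option R
  | .op _ r _ => some r
  | .val r _ => some r
  | .load r _ _ => some r
  | .loadGuess r _ _ _ _ => some r
  | .loadVal r _ _ _ _ => some r
  | _ => none

/-- The value available for the assigned register: it is known for resolved operations and loads,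
and for loads whose value has been predicted. -/
def TransInstr.value {R V L Op : Type*} : TransInstr R V L Op → Option (LVal V L)
  | .val _ v => some v
  | .loadGuess _ _ v _ _ => some v
  | .loadVal _ v _ _ _ => some v
  | _ => none

/-- `t = store(_, a)`: a transient store whose address is resolved to `a`. -/
def TransInstr.StoresTo {R V L Op : Type*} (t : TransInstr R V L Op) (a : V) : Prop :=
  ∃ rv l, t = .store rv (.resolved a l)

/-- `t` is a resolved load, fetched at program point `n`, that conflicts with the store at index
`i` having address `a`: it has used the address `a` but the data of memory or of a store older than
`i`, or it has used the data of the store at `i` but another address.  (`⊥ < i` for every `i`.) -/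
def TransInstr.Hazard {R V L Op : Type*} (t : TransInstr R V L Op) (i : ℕ) (a n : V) : Prop :=
  ∃ r v dep a', t = .loadVal r v dep a' n ∧
    ((a' = a ∧ dep < (i : WithBot ℕ)) ∨ (dep = (i : WithBot ℕ) ∧ a' ≠ a))

/-- A memory cell holds an instruction or a datum. -/
inductive Cell (R V L Op : Type*) where
  | instr (I : Instr R V L Op)
  | data (v : LVal V L)

/-! ### Maps indexed by natural numbers -/

/-- Smallest index in the domain, `0` for the empty map. -/
noncomputable def minIdx {α : Type*} (M : ℕ → Option α) : ℕ := sInf {i | M i ≠ none}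

/-- Largest index in the domain, `0` for the empty map. -/
noncomputable def maxIdx {α : Type*} (M : ℕ → Option α) : ℕ := sSup {i | M i ≠ none}

/-- `M[j : j < i]` -/
def below {α : Type*} (M : ℕ → Option α) (i : ℕ) : ℕ → Option α :=
  fun j => if j < i then M j else none

/-- `M[j : j > i]` -/
def above {α : Type*} (M : ℕ → Option α) (i : ℕ) : ℕ → Option α :=
  fun j => if i < j then M j else none

/-! ### Return stack buffer -/

inductive RsbCmd (V : Type*) where
  | push (n : V)
  | pop

/-- The stack (top first) after applying to the empty stack, in the order of indices, the commands
of `σ` at indices below the given bound.  Popping the empty stack does nothing. -/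
def rsbStack {V : Type*} (σ : ℕ → Option (RsbCmd V)) : ℕ → List V
  | 0 => []
  | k + 1 =>
    match σ k with
    | none => rsbStack σ k
    | some (.push n) => n :: rsbStack σ k
    | some .pop => (rsbStack σ k).tail

/-- The top of the return stack buffer, `none` (i.e. `⊥`) if the stack is empty. -/
noncomputable def rsbTop {V : Type*} (σ : ℕ → Option (RsbCmd V)) : Option V :=
  (rsbStack σ (maxIdx σ + 1)).head?

/-! ### Configurations -/

/-- A configuration `(ρ, μ, n, buf)`. -/
structure Config (R V L Op : Type*) where
  /-- register map `ρ` -/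
  reg : R → Option (LVal V L)
  /-- memory `μ` -/
  mem : V → Option (Cell R V L Op)
  /-- program point `n` -/
  pc : V
  /-- reorder buffer -/
  buf : ℕ → Option (TransInstr R V L Op)

/-- A configuration extended with a return stack buffer `σ`. -/
structure ExtConfig (R V L Op : Type*) extends Config R V L Op where
  rsb : ℕ → Option (RsbCmd V)

/-- The reorder buffer is empty.  Such configurations are called initial, and also terminal. -/
def Config.EmptyBuf {R V L Op : Type*} (C : Config R V L Op) : Prop := ∀ i, C.buf i = none

abbrev Config.IsInitial {R V L Op : Type*} (C : Config R V L Op) : Prop := C.EmptyBuf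

abbrev Config.IsTerminal {R V L Op : Type*} (C : Config R V L Op) : Prop := C.EmptyBuf

/-- `C₁ ≈ C₂`: same memory and same register map. -/
def Config.Approx {R V L Op : Type*} (C₁ C₂ : Config R V L Op) : Prop :=
  C₁.mem = C₂.mem ∧ C₁.reg = C₂.reg

/-- What the semantics is parametric in: the (partial) evaluation of opcodes and of branch
conditions, the (partial) computation of addresses and jump targets from operand values,
the opcodes moving the stack pointer, the stack pointer register `rsp` and the temporary register
`rret` used by returns.  No law is required of them. -/
structure Arch (R V L Op : Type*) where
  evalOp : Op → List (LVal V L) → Option (LVal V L)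
  evalCond : Op → List (LVal V L) → Option Bool
  addr : List (LVal V L) → Option V
  succ : Op
  pred : Op
  rsp : R
  rret : R

open Classical in
/-- Register resolve function: the value of `r` as seen by the instruction at index `i`, i.e. the
value of the latest assignment to `r` at an index `j < i` of the buffer (undefined if that
assignment has no value yet), or `ρ(r)` if there is no such assignment. -/
noncomputable def Config.resolveReg {R V L Op : Type*} (C : Config R V L Op) (r : R) :
    ℕ → Option (LVal V L)
  | 0 => C.reg r
  | j + 1 =>
    match C.buf j with
    | none => C.resolveReg r j
    | some t => if t.dest = some r then t.value else C.resolveReg r j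

/-- The resolve function on operands. -/
noncomputable def Config.resolve {R V L Op : Type*} (C : Config R V L Op) (i : ℕ) :
    Operand R V L → Option (LVal V L)
  | .reg r => C.resolveReg r i
  | .val v => some v

/-- All operands in `rvs` are defined at index `i`, with values `vs`. -/
def Config.Resolves {R V L Op : Type*} (C : Config R V L Op) (i : ℕ)
    (rvs : List (Operand R V L)) (vs : List (LVal V L)) : Prop :=
  rvs.map (C.resolve i) = vs.map some

/-- No fence is pending before index `i`. -/
def Config.NoFence {R V L Op : Type*} (C : Config R V L Op) (i : ℕ) : Prop :=
  ∀ j < i, C.buf j ≠ some .fence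

/-- No store before index `i` has its address resolved to `a`. -/
def Config.NoStore {R V L Op : Type*} (C : Config R V L Op) (i : ℕ) (a : V) : Prop :=
  ∀ j < i, ∀ t, C.buf j = some t → ¬ t.StoresTo a

/-- The first index of the block of transient instructions that the fetch producing the load at
index `k` has put into the buffer: the load fetched for a return is preceded by the `ret` marker,
any other load stands alone. -/
noncomputable def Config.fetchStart {R V L Op : Type*} (C : Config R V L Op) (k : ℕ) : ℕ :=
  open Classical in if C.buf (k - 1) = some .ret then k - 1 else k

/-- The fresh index of the reorder buffer. -/
noncomputable def Config.fresh {R V L Op : Type*} (C : Config R V L Op) : ℕ := maxIdx C.buf + 1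

/-- `a` is not the address of an instruction, so that data may be written to it. -/
def Config.IsDataAddr {R V L Op : Type*} (C : Config R V L Op) (a : V) : Prop :=
  ∀ I, C.mem a ≠ some (.instr I)

/-- Join of the labels of a list of values. -/
def joinLab {V L : Type*} [Lattice L] [OrderBot L] (vs : List (LVal V L)) : L :=
  (vs.map LVal.lab).foldr (· ⊔ ·) ⊥

/-! ### Directives, observations, steps -/

/-- Directives of a schedule. -/
inductive Directive (V : Type*) where
  | fetch
  /-- `fetch: b`, guessing a conditional branch -/
  | fetchBr (b : Bool)
  /-- `fetch: n`, guessing a jump target -/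
  | fetchTo (n : V)
  /-- `execute i` -/
  | execute (i : ℕ)
  /-- `execute i : fwd j`, guessing that the load at `i` aliases the store at `j` -/
  | executeFwd (i j : ℕ)
  /-- `execute i : value` -/
  | executeValue (i : ℕ)
  /-- `execute i : addr` -/
  | executeAddr (i : ℕ)
  | retire

def Directive.isRetire {V : Type*} : Directive V → Bool
  | .retire => true
  | _ => false

/-- Leakage observations. -/
inductive Obs (V L : Type*) where
  | read (a : V) (l : L)
  | fwd (a : V) (l : L)
  | write (a : V) (l : L)
  | jump (n : V) (l : L)
  | rollback

/-- `Step A C d o C'`: under directive `d`, configuration `C` steps to `C'` with leakage `o` (the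
list of observations made in the step). -/
inductive Step {R V L Op : Type*} [DecidableEq R] [DecidableEq V] [Lattice L] [OrderBot L]
    (A : Arch R V L Op) :
    ExtConfig R V L Op → Directive V → List (Obs V L) → ExtConfig R V L Op → Prop
  -- fetch stage
  | opFetch (C : ExtConfig R V L Op) (o r rvs n')
      (hI : C.mem C.pc = some (.instr (.op o r rvs n'))) :
      Step A C .fetch []
        { C with pc := n', buf := Function.update C.buf C.fresh (some (.op o r rvs)) }
  | loadFetch (C : ExtConfig R V L Op) (r rvs n')
      (hI : C.mem C.pc = some (.instr (.load r rvs n'))) :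
      Step A C .fetch []
        { C with pc := n', buf := Function.update C.buf C.fresh (some (.load r rvs C.pc)) }
  | storeFetch (C : ExtConfig R V L Op) (rv rvs n')
      (hI : C.mem C.pc = some (.instr (.store rv rvs n'))) :
      Step A C .fetch []
        { C with pc := n', buf := Function.update C.buf C.fresh (some (.store rv (.args rvs))) }
  | fenceFetch (C : ExtConfig R V L Op) (n')
      (hI : C.mem C.pc = some (.instr (.fence n'))) :
      Step A C .fetch []
        { C with pc := n', buf := Function.update C.buf C.fresh (some .fence) }
  | brFetch (C : ExtConfig R V L Op) (b : Bool) (o rvs nT nF)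
      (hI : C.mem C.pc = some (.instr (.br o rvs nT nF))) :
      Step A C (.fetchBr b) []
        { C with
          pc := if b then nT else nF
          buf := Function.update C.buf C.fresh
            (some (.br o rvs (if b then nT else nF) nT nF)) }
  | jmpiFetch (C : ExtConfig R V L Op) (n' : V) (rvs)
      (hI : C.mem C.pc = some (.instr (.jmpi rvs))) :
      Step A C (.fetchTo n') []
        { C with pc := n', buf := Function.update C.buf C.fresh (some (.jmpi rvs n')) }
  | callFetch (C : ExtConfig R V L Op) (nf nret)
      (hI : C.mem C.pc = some (.instr (.call nf nret))) :
      Step A C .fetch []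
        { C with
          pc := nf
          buf := Function.update (Function.update (Function.update C.buf
            C.fresh (some .call))
            (C.fresh + 1) (some (.op A.succ A.rsp [.reg A.rsp])))
            (C.fresh + 2) (some (.store (.val ⟨nret, ⊥⟩) (.args [.reg A.rsp])))
          rsb := Function.update C.rsb C.fresh (some (.push nret)) }
  | retFetchRsb (C : ExtConfig R V L Op) (n' : V)
      (hI : C.mem C.pc = some (.instr .ret)) (hσ : rsbTop C.rsb = some n') :
      Step A C .fetch []
        { C with
          pc := n'
          buf := Function.update (Function.update (Function.update (Function.update C.buf
            C.fresh (some .ret))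
            (C.fresh + 1) (some (.load A.rret [.reg A.rsp] C.pc)))
            (C.fresh + 2) (some (.op A.pred A.rsp [.reg A.rsp])))
            (C.fresh + 3) (some (.jmpi [.reg A.rret] n'))
          rsb := Function.update C.rsb C.fresh (some .pop) }
  | retFetchRsbEmpty (C : ExtConfig R V L Op) (n' : V)
      (hI : C.mem C.pc = some (.instr .ret)) (hσ : rsbTop C.rsb = none) :
      Step A C (.fetchTo n') []
        { C with
          pc := n'
          buf := Function.update (Function.update (Function.update (Function.update C.buf
            C.fresh (some .ret))
            (C.fresh + 1) (some (.load A.rret [.reg A.rsp] C.pc)))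
            (C.fresh + 2) (some (.op A.pred A.rsp [.reg A.rsp])))
            (C.fresh + 3) (some (.jmpi [.reg A.rret] n'))
          rsb := Function.update C.rsb C.fresh (some .pop) }
  -- execute stage: operations and jumps
  | opExecute (C : ExtConfig R V L Op) (i o r rvs vs v)
      (hi : C.buf i = some (.op o r rvs)) (hf : C.NoFence i)
      (hr : C.Resolves i rvs vs) (hv : A.evalOp o vs = some v) :
      Step A C (.execute i) []
        { C with buf := Function.update C.buf i (some (.val r v)) }
  | brExecuteCorrect (C : ExtConfig R V L Op) (i o rvs n₀ nT nF vs) (b : Bool)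
      (hi : C.buf i = some (.br o rvs n₀ nT nF)) (hf : C.NoFence i)
      (hr : C.Resolves i rvs vs) (hb : A.evalCond o vs = some b)
      (hn : (if b then nT else nF) = n₀) :
      Step A C (.execute i) [.jump n₀ (joinLab vs)]
        { C with buf := Function.update C.buf i (some (.jump n₀)) }
  | brExecuteIncorrect (C : ExtConfig R V L Op) (i o rvs n₀ nT nF vs) (b : Bool) (n' : V)
      (hi : C.buf i = some (.br o rvs n₀ nT nF)) (hf : C.NoFence i)
      (hr : C.Resolves i rvs vs) (hb : A.evalCond o vs = some b)
      (hn' : (if b then nT else nF) = n') (hn : n' ≠ n₀) :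
      Step A C (.execute i) [.rollback, .jump n' (joinLab vs)]
        { C with
          pc := n'
          buf := Function.update (below C.buf i) i (some (.jump n'))
          rsb := below C.rsb i }
  | jmpiExecuteCorrect (C : ExtConfig R V L Op) (i rvs n₀ vs)
      (hi : C.buf i = some (.jmpi rvs n₀)) (hf : C.NoFence i)
      (hr : C.Resolves i rvs vs) (ha : A.addr vs = some n₀) :
      Step A C (.execute i) [.jump n₀ (joinLab vs)]
        { C with buf := Function.update C.buf i (some (.jump n₀)) }
  | jmpiExecuteIncorrect (C : ExtConfig R V L Op) (i rvs n₀ vs) (n' : V)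
      (hi : C.buf i = some (.jmpi rvs n₀)) (hf : C.NoFence i)
      (hr : C.Resolves i rvs vs) (ha : A.addr vs = some n') (hn : n' ≠ n₀) :
      Step A C (.execute i) [.rollback, .jump n' (joinLab vs)]
        { C with
          pc := n'
          buf := Function.update (below C.buf i) i (some (.jump n'))
          rsb := below C.rsb i }
  -- execute stage: loads without alias prediction
  | loadExecuteNodep (C : ExtConfig R V L Op) (i r rvs n vs a v)
      (hi : C.buf i = some (.load r rvs n)) (hf : C.NoFence i)
      (hr : C.Resolves i rvs vs) (ha : A.addr vs = some a)
      (hs : C.NoStore i a) (hm : C.mem a = some (.data v)) :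
      Step A C (.execute i) [.read a (joinLab vs)]
        { C with buf := Function.update C.buf i (some (.loadVal r v ⊥ a n)) }
  | loadExecuteForward (C : ExtConfig R V L Op) (i r rvs n vs a j v l)
      (hi : C.buf i = some (.load r rvs n)) (hf : C.NoFence i)
      (hr : C.Resolves i rvs vs) (ha : A.addr vs = some a)
      (hji : j < i) (hj : C.buf j = some (.store (.val v) (.resolved a l)))
      (hmax : ∀ k, j < k → k < i → ∀ t, C.buf k = some t → ¬ t.StoresTo a) :
      Step A C (.execute i) [.fwd a (joinLab vs)]
        { C with buf := Function.update C.buf i (some (.loadVal r v (j : ℕ) a n)) }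
  -- execute stage: loads with alias prediction
  | loadExecuteGuess (C : ExtConfig R V L Op) (i r rvs n j v ad)
      (hi : C.buf i = some (.load r rvs n)) (hf : C.NoFence i)
      (hji : j < i) (hj : C.buf j = some (.store (.val v) ad)) :
      Step A C (.executeFwd i j) []
        { C with buf := Function.update C.buf i (some (.loadGuess r rvs v j n)) }
  | loadExecuteAddrOk (C : ExtConfig R V L Op) (i r rvs v j n vs a ad)
      (hi : C.buf i = some (.loadGuess r rvs v j n)) (hf : C.NoFence i)
      (hr : C.Resolves i rvs vs) (ha : A.addr vs = some a)
      (hj : C.buf j = some (.store (.val v) ad))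
      (had : ∀ a' l, ad = .resolved a' l → a' = a)
      (hmax : ∀ k, j < k → k < i → ∀ t, C.buf k = some t → ¬ t.StoresTo a) :
      Step A C (.execute i) [.fwd a (joinLab vs)]
        { C with buf := Function.update C.buf i (some (.loadVal r v (j : ℕ) a n)) }
  | loadExecuteAddrHazard (C : ExtConfig R V L Op) (i r rvs v j n vs a)
      (hi : C.buf i = some (.loadGuess r rvs v j n)) (hf : C.NoFence i)
      (hr : C.Resolves i rvs vs) (ha : A.addr vs = some a)
      (hz : (∃ a' l, C.buf j = some (.store (.val v) (.resolved a' l)) ∧ a' ≠ a) ∨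
        (∃ k t, j < k ∧ k < i ∧ C.buf k = some t ∧ t.StoresTo a)) :
      Step A C (.execute i) [.rollback, .fwd a (joinLab vs)]
        { C with
          pc := n
          buf := below C.buf (C.fetchStart i)
          rsb := below C.rsb (C.fetchStart i) }
  | loadExecuteMemMatch (C : ExtConfig R V L Op) (i r rvs v j n vs a)
      (hi : C.buf i = some (.loadGuess r rvs v j n)) (hf : C.NoFence i)
      (hr : C.Resolves i rvs vs) (ha : A.addr vs = some a)
      (hj : C.buf j = none) (hs : C.NoStore i a) (hm : C.mem a = some (.data v)) :
      Step A C (.execute i) [.read a (joinLab vs)]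
        { C with buf := Function.update C.buf i (some (.loadVal r v ⊥ a n)) }
  | loadExecuteMemHazard (C : ExtConfig R V L Op) (i r rvs v j n vs a v')
      (hi : C.buf i = some (.loadGuess r rvs v j n)) (hf : C.NoFence i)
      (hr : C.Resolves i rvs vs) (ha : A.addr vs = some a)
      (hj : C.buf j = none) (hs : C.NoStore i a) (hm : C.mem a = some (.data v'))
      (hv : v' ≠ v) :
      Step A C (.execute i) [.rollback, .read a (joinLab vs)]
        { C with
          pc := n
          buf := below C.buf (C.fetchStart i)
          rsb := below C.rsb (C.fetchStart i) }
  -- execute stage: stores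
  | storeExecuteValue (C : ExtConfig R V L Op) (i rv ad v)
      (hi : C.buf i = some (.store rv ad)) (hf : C.NoFence i)
      (hv : C.resolve i rv = some v) :
      Step A C (.executeValue i) []
        { C with buf := Function.update C.buf i (some (.store (.val v) ad)) }
  | storeExecuteAddrOk (C : ExtConfig R V L Op) (i rv rvs vs a)
      (hi : C.buf i = some (.store rv (.args rvs))) (hf : C.NoFence i)
      (hr : C.Resolves i rvs vs) (ha : A.addr vs = some a)
      (hz : ∀ k t n, i < k → C.buf k = some t → ¬ t.Hazard i a n) :
      Step A C (.executeAddr i) [.fwd a (joinLab vs)]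
        { C with buf := Function.update C.buf i (some (.store rv (.resolved a (joinLab vs)))) }
  | storeExecuteAddrHazard (C : ExtConfig R V L Op) (i rv rvs vs a k t n)
      (hi : C.buf i = some (.store rv (.args rvs))) (hf : C.NoFence i)
      (hr : C.Resolves i rvs vs) (ha : A.addr vs = some a)
      (hik : i < k) (hk : C.buf k = some t) (hz : t.Hazard i a n)
      (hmin : ∀ k' t' n', i < k' → k' < k → C.buf k' = some t' → ¬ t'.Hazard i a n') :
      Step A C (.executeAddr i) [.rollback, .fwd a (joinLab vs)]
        { C with
          pc := n
          buf := Function.update (below C.buf (C.fetchStart k)) i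
            (some (.store rv (.resolved a (joinLab vs))))
          rsb := below C.rsb (C.fetchStart k) }
  -- retire stage
  | valRetire (C : ExtConfig R V L Op) (i r v)
      (hmin : minIdx C.buf = i) (hi : C.buf i = some (.val r v)) :
      Step A C .retire []
        { C with
          reg := Function.update C.reg r (some v)
          buf := Function.update C.buf i none }
  | loadRetire (C : ExtConfig R V L Op) (i r v dep a n)
      (hmin : minIdx C.buf = i) (hi : C.buf i = some (.loadVal r v dep a n)) :
      Step A C .retire []
        { C with
          reg := Function.update C.reg r (some v)
          buf := Function.update C.buf i none }
  | jumpRetire (C : ExtConfig R V L Op) (i n₀)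
      (hmin : minIdx C.buf = i) (hi : C.buf i = some (.jump n₀)) :
      Step A C .retire [] { C with buf := Function.update C.buf i none }
  | fenceRetire (C : ExtConfig R V L Op) (i)
      (hmin : minIdx C.buf = i) (hi : C.buf i = some .fence) :
      Step A C .retire [] { C with buf := Function.update C.buf i none }
  | storeRetire (C : ExtConfig R V L Op) (i v a l)
      (hmin : minIdx C.buf = i) (hi : C.buf i = some (.store (.val v) (.resolved a l)))
      (hd : C.IsDataAddr a) :
      Step A C .retire [.write a l]
        { C with
          mem := Function.update C.mem a (some (.data v))
          buf := Function.update C.buf i none }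
  | callRetire (C : ExtConfig R V L Op) (i vsp vret a l)
      (hmin : minIdx C.buf = i) (hi : C.buf i = some .call)
      (hi1 : C.buf (i + 1) = some (.val A.rsp vsp))
      (hi2 : C.buf (i + 2) = some (.store (.val vret) (.resolved a l)))
      (hd : C.IsDataAddr a) :
      Step A C .retire [.write a l]
        { C with
          reg := Function.update C.reg A.rsp (some vsp)
          mem := Function.update C.mem a (some (.data vret))
          buf := above C.buf (i + 2) }
  | retRetire (C : ExtConfig R V L Op) (i v₁ dep a n v₂ n')
      (hmin : minIdx C.buf = i) (hi : C.buf i = some .ret)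
      (hi1 : C.buf (i + 1) = some (.loadVal A.rret v₁ dep a n))
      (hi2 : C.buf (i + 2) = some (.val A.rsp v₂))
      (hi3 : C.buf (i + 3) = some (.jump n')) :
      Step A C .retire []
        { C with
          reg := Function.update C.reg A.rsp (some v₂)
          buf := above C.buf (i + 3) }

/-- Sequences of steps; the schedule and the trace are the concatenations of the directives and
of the leakages. -/
inductive Steps {R V L Op : Type*} [DecidableEq R] [DecidableEq V] [Lattice L] [OrderBot L]
    (A : Arch R V L Op) :
    ExtConfig R V L Op → List (Directive V) → List (Obs V L) → ExtConfig R V L Op → Prop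
  | nil (C : ExtConfig R V L Op) : Steps A C [] [] C
  | cons {C C' C'' : ExtConfig R V L Op} {d : Directive V} {o : List (Obs V L)}
      {D : List (Directive V)} {O : List (Obs V L)}
      (h : Step A C d o C') (t : Steps A C' D O C'') : Steps A C (d :: D) (o ++ O) C''

/-- The big step `C ⇓ C'` under schedule `D`, with trace `O` and `N` retired instructions: `N` is
the number of `retire` directives in `D`. -/
def BigStep {R V L Op : Type*} [DecidableEq R] [DecidableEq V] [Lattice L] [OrderBot L]
    (A : Arch R V L Op) (N : ℕ) (C : ExtConfig R V L Op) (D : List (Directive V))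
    (O : List (Obs V L)) (C' : ExtConfig R V L Op) : Prop :=
  Steps A C D O C' ∧ D.countP Directive.isRetire = N

/-- No instruction stored in memory has the register `r` among its operands. -/
def Config.NeverReads {R V L Op : Type*} (C : Config R V L Op) (r : R) : Prop :=
  ∀ n I, C.mem n = some (.instr I) → Operand.reg r ∉ I.operands

end SpecMachine

/-! Speculation affects only what is in flight. What has been retired is always the result of a
deterministic sequential execution, and the number of retired instructions says how far that
execution has gone. The sequential machine is the partial function `SeqState.steps`, which depends
on the initial state and `N` but on no schedule. Two executions with the same `N` have therefore
committed the same registers and memory.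

The link is the invariant `Inv`. Calls and returns are split into micro-operations, so that each
buffer entry belongs to a location (program point, offset in its block). The buffer is a gapless
interval `[lo, hi)` whose entries follow a path `g` of locations (`Core`). The path starts where the
sequential machine stands and ends at the current program point. An entry (`Entry`) is correct
relative to the older entries only: a resolved value is what its operands, read through the buffer,
evaluate to. A predicted target is simply taken as the next location, and a guessed load value is
not constrained at all. A resolved load satisfies `LoadOK`: no store known to be newer than its
source writes to its address, and its source, a store or the memory, still supplies its value.

A fetch lengthens the path, an execution refines one entry, and a rollback cuts the path. A
retirement commits the head, which has no older entries, so correctness relative to the buffer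
becomes correctness relative to the registers and memory (`Core.microStep`), while the younger
entries stay correct (`Core.commit`). The condition that `lo` has offset 0 ensures that whole blocks
are retired. `Inv.of_step` collects these cases. If the buffer is empty, so is the path, and the
program point is determined as well.

The return stack buffer is absent from the invariant, since it only supplies predictions. The
register `rret` is written sequentially by a return but not by its retirement; `Core.change_rret`
shows that the difference cannot be observed. -/

namespace SpecMachine

variable {R V L Op : Type*}

/-! ### Micro-operations -/

/-- A location: a program point together with an offset into the block fetched there. -/
abbrev Loc (V : Type*) := V × ℕ

/-- The instructions that occupy single entries of the reorder buffer, with the location that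
follows. -/
inductive Micro (R V L Op : Type*) where
  | op (o : Op) (r : R) (rvs : List (Operand R V L)) (l : Loc V)
  | br (o : Op) (rvs : List (Operand R V L)) (nT nF : V)
  | load (r : R) (rvs : List (Operand R V L)) (l : Loc V)
  | store (rv : Operand R V L) (rvs : List (Operand R V L)) (l : Loc V)
  | jmpi (rvs : List (Operand R V L))
  | call (l : Loc V)
  | ret (l : Loc V)
  | fence (l : Loc V)

def Micro.operands : Micro R V L Op → List (Operand R V L)
  | .op _ _ rvs _ => rvs
  | .br _ rvs _ _ => rvs
  | .load _ rvs _ => rvs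
  | .store rv rvs _ => rv :: rvs
  | .jmpi rvs => rvs
  | _ => []

/-- The location following a micro-operation that does not jump. -/
def Micro.next : Micro R V L Op → Option (Loc V)
  | .op _ _ _ l | .load _ _ l | .store _ _ l | .call l | .ret l | .fence l => some l
  | .br _ _ _ _ | .jmpi _ => none

/-- The micro-operation at offset `k` of the block fetched at program point `n` for `I`. -/
def Instr.micro [Lattice L] [OrderBot L] (A : Arch R V L Op) (n : V) :
    Instr R V L Op → ℕ → Option (Micro R V L Op)
  | .op o r rvs n', 0 => some (.op o r rvs (n', 0))
  | .br o rvs nT nF, 0 => some (.br o rvs nT nF)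
  | .load r rvs n', 0 => some (.load r rvs (n', 0))
  | .store rv rvs n', 0 => some (.store rv rvs (n', 0))
  | .jmpi rvs, 0 => some (.jmpi rvs)
  | .call _ _, 0 => some (.call (n, 1))
  | .call _ _, 1 => some (.op A.succ A.rsp [.reg A.rsp] (n, 2))
  | .call nf nret, 2 => some (.store (.val ⟨nret, ⊥⟩) [.reg A.rsp] (nf, 0))
  | .ret, 0 => some (.ret (n, 1))
  | .ret, 1 => some (.load A.rret [.reg A.rsp] (n, 2))
  | .ret, 2 => some (.op A.pred A.rsp [.reg A.rsp] (n, 3))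
  | .ret, 3 => some (.jmpi [.reg A.rret])
  | .fence n', 0 => some (.fence (n', 0))
  | _, _ => none

/-- `M` is the micro-operation at location `l` of the memory `μ`. -/
def MicroAt [Lattice L] [OrderBot L] (A : Arch R V L Op) (μ : V → Option (Cell R V L Op))
    (l : Loc V) (M : Micro R V L Op) : Prop :=
  ∃ I, μ l.1 = some (.instr I) ∧ I.micro A l.1 l.2 = some M

/-- The load at index `i`, resolved to address `a` and value `v` from `dep`, has not been found to
be wrong: no store between `dep` and `i` is known to write to `a`, and `v` is the value of the store
at `dep`, or of the memory if that store has been retired. -/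
def Config.LoadOK (C : Config R V L Op) (i : ℕ) (v : LVal V L) (dep : WithBot ℕ) (a : V) : Prop :=
  dep < i ∧
  (∀ k < i, dep < (k : WithBot ℕ) → ∀ t, C.buf k = some t → ¬ t.StoresTo a) ∧
  ((∃ (j : ℕ) (ad : _), dep = j ∧ C.buf j = some (.store (.val v) ad) ∧
      ∀ a' l, ad = .resolved a' l → a' = a) ∨
    ((∀ j : ℕ, dep = j → C.buf j = none) ∧ C.mem a = some (.data v)))

/-- The entry `t` at index `i` is a correct form of the micro-operation `M` of the block fetched at
program point `n`, relative to the earlier entries, and `l` is the location of the next entry. -/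
inductive Entry (A : Arch R V L Op) (C : Config R V L Op) (i : ℕ) (n : V) :
    Micro R V L Op → TransInstr R V L Op → Loc V → Prop
  | op (o r rvs l) : Entry A C i n (.op o r rvs l) (.op o r rvs) l
  | val (o r rvs l vs v) (hr : C.Resolves i rvs vs) (hv : A.evalOp o vs = some v) :
      Entry A C i n (.op o r rvs l) (.val r v) l
  | br (o rvs n₀ nT nF) : Entry A C i n (.br o rvs nT nF) (.br o rvs n₀ nT nF) (n₀, 0)
  | brJump (o rvs nT nF vs b n₀) (hr : C.Resolves i rvs vs) (hb : A.evalCond o vs = some b)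
      (hn : (if b then nT else nF) = n₀) :
      Entry A C i n (.br o rvs nT nF) (.jump n₀) (n₀, 0)
  | load (r rvs l) : Entry A C i n (.load r rvs l) (.load r rvs n) l
  | loadGuess (r rvs l v j) (hj : j < i) :
      Entry A C i n (.load r rvs l) (.loadGuess r rvs v j n) l
  | loadVal (r rvs l vs v dep a) (hr : C.Resolves i rvs vs) (ha : A.addr vs = some a)
      (hl : C.LoadOK i v dep a) :
      Entry A C i n (.load r rvs l) (.loadVal r v dep a n) l
  | store (rv rvs l rv' ad) (hv : rv' = rv ∨ ∃ v, rv' = .val v ∧ C.resolve i rv = some v)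
      (ha : ad = .args rvs ∨
        ∃ vs a lab, ad = .resolved a lab ∧ C.Resolves i rvs vs ∧ A.addr vs = some a) :
      Entry A C i n (.store rv rvs l) (.store rv' ad) l
  | jmpi (rvs n₀) : Entry A C i n (.jmpi rvs) (.jmpi rvs n₀) (n₀, 0)
  | jmpiJump (rvs vs n₀) (hr : C.Resolves i rvs vs) (ha : A.addr vs = some n₀) :
      Entry A C i n (.jmpi rvs) (.jump n₀) (n₀, 0)
  | call (l) : Entry A C i n (.call l) .call l
  | ret (l) : Entry A C i n (.ret l) .ret l
  | fence (l) : Entry A C i n (.fence l) .fence l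

/-- The buffer of `C` occupies the indices from `lo` up to `hi`, and its entries are correct forms
of the micro-operations along the path of locations `g`. -/
structure Core [Lattice L] [OrderBot L] (A : Arch R V L Op) (C : Config R V L Op) (lo hi : ℕ)
    (g : ℕ → Loc V) : Prop where
  pos : 1 ≤ lo
  le : lo ≤ hi
  lt_lo : ∀ i < lo, C.buf i = none
  ge_hi : ∀ i, hi ≤ i → C.buf i = none
  entry : ∀ i, lo ≤ i → i < hi → ∃ M t, MicroAt A C.mem (g i) M ∧ C.buf i = some t ∧
    Entry A C i (g i).1 M t (g (i + 1))

/-! ### Resolution of registers -/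

theorem Config.resolveReg_congr {C C' : Config R V L Op} {i : ℕ} (hreg : C'.reg = C.reg)
    (hbuf : ∀ j < i, C'.buf j = C.buf j) (r : R) : C'.resolveReg r i = C.resolveReg r i := by
  induction i with
  | zero => simp [Config.resolveReg, hreg]
  | succ i ih =>
    simp only [Config.resolveReg]
    rw [hbuf i (by omega), ih (fun j hj => hbuf j (by omega))]

theorem Config.resolveReg_eq_reg {C : Config R V L Op} {i : ℕ} (h : ∀ j < i, C.buf j = none)
    (r : R) : C.resolveReg r i = C.reg r := by
  induction i with
  | zero => rfl
  | succ i ih =>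
    simp only [Config.resolveReg]
    rw [h i (by omega), ih (fun j hj => h j (by omega))]

/-- Replacing an entry by a more resolved form preserves the values of registers. -/
theorem Config.resolveReg_refine {C C' : Config R V L Op} {m : ℕ} {t t' : TransInstr R V L Op}
    (hreg : C'.reg = C.reg) (hbuf : C'.buf = Function.update C.buf m (some t'))
    (hm : C.buf m = some t) (hdest : t'.dest = t.dest)
    (hval : ∀ v, t.value = some v → t'.value = some v) (i : ℕ) (r : R) (v : LVal V L)
    (h : C.resolveReg r i = some v) : C'.resolveReg r i = some v := by
  induction i with
  | zero => simpa [Config.resolveReg, hreg] using h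
  | succ i ih =>
    simp only [Config.resolveReg] at h ⊢
    by_cases him : i = m
    · subst him
      simp only [hm, hbuf, Function.update_self, hdest] at h ⊢
      by_cases hd : t.dest = some r
      · rw [if_pos hd] at h
        rw [if_pos (hdest.trans hd)]
        exact hval v h
      · rw [if_neg hd] at h
        rw [if_neg (hdest ▸ hd)]
        exact ih h
    · rw [hbuf, Function.update_of_ne him]
      cases hb : C.buf i with
      | none => simp only [hb] at h ⊢; exact ih h
      | some s =>
        simp only [hb] at h ⊢
        split_ifs at h ⊢ with hd
        · exact h
        · exact ih h

/-- Above the oldest entry, its commitment to the register map cannot be seen. -/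
theorem Config.resolveReg_commit {C C' : Config R V L Op} {m : ℕ} {t : TransInstr R V L Op}
    (hlt : ∀ j < m, C.buf j = none) (hm : C.buf m = some t)
    (hbuf : C'.buf = Function.update C.buf m none)
    (hreg : ∀ r, (t.dest = some r → C'.reg r = t.value) ∧ (t.dest ≠ some r → C'.reg r = C.reg r))
    (i : ℕ) (hi : m < i) (r : R) : C'.resolveReg r i = C.resolveReg r i := by
  induction i with
  | zero => omega
  | succ i ih =>
    simp only [Config.resolveReg]
    by_cases him : i = m
    · subst him
      -- Both buffers are empty below the oldest entry, so the comparison is between its effect and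
      -- the two register maps.
      rw [hm, hbuf, Function.update_self, Config.resolveReg_eq_reg hlt,
        Config.resolveReg_eq_reg]
      · dsimp only
        split_ifs with hd
        · exact (hreg r).1 hd
        · exact (hreg r).2 hd
      · intro j hj
        rw [hbuf, Function.update_of_ne (by omega), hlt j hj]
    · rw [hbuf, Function.update_of_ne him, ih (by omega)]

/-- A register assigned in the buffer does not depend on the register map. -/
theorem Config.resolveReg_of_dest {C C' : Config R V L Op} {i j : ℕ} {t : TransInstr R V L Op}
    {r : R} (hbuf : C'.buf = C.buf) (hji : j < i) (hj : C.buf j = some t)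
    (ht : t.dest = some r) : C'.resolveReg r i = C.resolveReg r i := by
  induction i with
  | zero => omega
  | succ i ih =>
    simp only [Config.resolveReg, hbuf]
    by_cases h : j = i
    · subst h
      simp [hj, ht]
    · rw [ih (by omega)]

theorem Config.resolveReg_congr_reg {C C' : Config R V L Op} {r : R} (hbuf : C'.buf = C.buf)
    (hreg : C'.reg r = C.reg r) (i : ℕ) : C'.resolveReg r i = C.resolveReg r i := by
  induction i with
  | zero => exact hreg
  | succ i ih => simp only [Config.resolveReg, hbuf, ih]

theorem Config.resolve_mono {C C' : Config R V L Op} {i : ℕ} {rv : Operand R V L}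
    (h : ∀ r, rv = .reg r → ∀ v, C.resolveReg r i = some v → C'.resolveReg r i = some v)
    {v : LVal V L} (hv : C.resolve i rv = some v) : C'.resolve i rv = some v := by
  cases rv with
  | reg r => exact h r rfl v hv
  | val w => exact hv

theorem Config.Resolves.mono {C C' : Config R V L Op} {i : ℕ} {rvs : List (Operand R V L)}
    (h : ∀ r, .reg r ∈ rvs → ∀ v, C.resolveReg r i = some v → C'.resolveReg r i = some v)
    {vs : List (LVal V L)} (hv : C.Resolves i rvs vs) : C'.Resolves i rvs vs := by
  unfold Config.Resolves at *
  induction rvs generalizing vs with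
  | nil => simpa using hv
  | cons a rvs ih =>
    cases vs with
    | nil => simp at hv
    | cons w vs =>
      simp only [List.map_cons, List.cons.injEq] at hv ⊢
      refine ⟨Config.resolve_mono (fun r hr => h r (by simp [hr])) hv.1, ih (fun r hr => ?_) hv.2⟩
      exact h r (by simp [hr])

/-! ### How the correctness of an entry depends on the configuration. -/

theorem Config.LoadOK.congr {C C' : Config R V L Op} {i : ℕ} {v : LVal V L} {dep : WithBot ℕ}
    {a : V} (hmem : C'.mem = C.mem) (hbuf : ∀ j < i, C'.buf j = C.buf j)
    (h : C.LoadOK i v dep a) : C'.LoadOK i v dep a := by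
  obtain ⟨h1, h2, h3⟩ := h
  refine ⟨h1, fun k hk hd t ht => h2 k hk hd t (by rw [← hbuf k hk, ht]), ?_⟩
  rcases h3 with ⟨j, ad, rfl, hj, had⟩ | ⟨hj, hm⟩
  · exact .inl ⟨j, ad, rfl, by rw [hbuf j (by exact_mod_cast h1), hj], had⟩
  · refine .inr ⟨fun j hdj => ?_, by rw [hmem, hm]⟩
    subst hdj
    rw [hbuf j (by exact_mod_cast h1), hj j rfl]

/-- An entry refers to the configuration only through defined operand values and `LoadOK`, and both
occur positively. Operands may thus become defined, but defined values must not change. -/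
theorem Entry.mono {A : Arch R V L Op} {C C' : Config R V L Op} {i : ℕ} {n : V}
    {M : Micro R V L Op} {t : TransInstr R V L Op} {l : Loc V} (h : Entry A C i n M t l)
    (hr : ∀ r, .reg r ∈ M.operands → ∀ v, C.resolveReg r i = some v → C'.resolveReg r i = some v)
    (hl : ∀ r v dep a n, t = .loadVal r v dep a n → C.LoadOK i v dep a → C'.LoadOK i v dep a) :
    Entry A C' i n M t l := by
  cases h with
  | op => constructor
  | val o r rvs l vs v h1 hv => exact .val o r rvs l vs v (h1.mono hr) hv
  | br => constructor
  | brJump o rvs nT nF vs b n₀ h1 hb hn => exact .brJump o rvs nT nF vs b n₀ (h1.mono hr) hb hn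
  | load => constructor
  | loadGuess r rvs l v j hj => exact .loadGuess r rvs l v j hj
  | loadVal r rvs l vs v dep a h1 ha h2 =>
    exact .loadVal r rvs l vs v dep a (h1.mono hr) ha (hl _ _ _ _ _ rfl h2)
  | store rv rvs l rv' ad hv ha =>
    refine .store rv rvs l rv' ad (hv.imp_right ?_) (ha.imp_right ?_)
    · rintro ⟨v, rfl, h⟩
      exact ⟨v, rfl, Config.resolve_mono (fun r h' => hr r (by simp [Micro.operands, h'])) h⟩
    · rintro ⟨vs, a, lab, rfl, h, ha⟩
      exact ⟨vs, a, lab, rfl, h.mono fun r h' => hr r (by simp [Micro.operands, h']), ha⟩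
  | jmpi => constructor
  | jmpiJump rvs vs n₀ h1 ha => exact .jmpiJump rvs vs n₀ (h1.mono hr) ha
  | call => constructor
  | ret => constructor
  | fence => constructor

theorem Entry.congr {A : Arch R V L Op} {C C' : Config R V L Op} {i : ℕ} {n : V}
    {M : Micro R V L Op} {t : TransInstr R V L Op} {l : Loc V} (h : Entry A C i n M t l)
    (hreg : C'.reg = C.reg) (hmem : C'.mem = C.mem) (hbuf : ∀ j < i, C'.buf j = C.buf j) :
    Entry A C' i n M t l :=
  h.mono (fun r _ v hv => by rw [Config.resolveReg_congr hreg hbuf, hv])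
    fun _ _ _ _ _ _ h' => h'.congr hmem hbuf

/-! ### Stability of resolved loads when one buffer entry changes. -/

section
variable {C C' : Config R V L Op}

/-- `LoadOK` inspects only stores and whether the source is still present, so replacing or removing
any other entry is harmless. -/
theorem Config.LoadOK.update_of_not_store {m : ℕ} {t : TransInstr R V L Op}
    {t' : Option (TransInstr R V L Op)}
    (hm : C.buf m = some t) (ht : ∀ rv ad, t ≠ .store rv ad) (ht' : ∀ rv ad, t' ≠ some (.store rv ad))
    (hmem : C'.mem = C.mem) (hbuf : C'.buf = Function.update C.buf m t')
    {i : ℕ} {v : LVal V L} {dep : WithBot ℕ} {a : V} (h : C.LoadOK i v dep a) :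
    C'.LoadOK i v dep a := by
  obtain ⟨h1, h2, h3⟩ := h
  refine ⟨h1, fun k hk hd s hs => ?_, ?_⟩
  · by_cases hkm : k = m
    · subst hkm
      rw [hbuf, Function.update_self] at hs
      rintro ⟨rv, l, rfl⟩
      exact ht' _ _ hs
    · rw [hbuf, Function.update_of_ne hkm] at hs
      exact h2 k hk hd s hs
  rcases h3 with ⟨j, ad, rfl, hj, had⟩ | ⟨hj, hma⟩
  · refine .inl ⟨j, ad, rfl, ?_, had⟩
    rw [hbuf, Function.update_of_ne, hj]
    rintro rfl
    exact ht _ _ (Option.some.inj (hm.symm.trans hj))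
  · refine .inr ⟨fun j hdj => ?_, by rw [hmem, hma]⟩
    rw [hbuf, Function.update_of_ne, hj j hdj]
    rintro rfl
    simp [hj j hdj] at hm

/-- The store at `m` gets its value. -/
theorem Config.LoadOK.update_storeValue {m : ℕ} {rv : Operand R V L} {ad : StoreAddr R V L}
    {w : LVal V L} (hm : C.buf m = some (.store rv ad)) (hw : C.resolve m rv = some w)
    (hmem : C'.mem = C.mem)
    (hbuf : C'.buf = Function.update C.buf m (some (.store (.val w) ad)))
    {i : ℕ} {v : LVal V L} {dep : WithBot ℕ} {a : V} (h : C.LoadOK i v dep a) :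
    C'.LoadOK i v dep a := by
  obtain ⟨h1, h2, h3⟩ := h
  refine ⟨h1, fun k hk hd s hs => ?_, ?_⟩
  · by_cases hkm : k = m
    · subst hkm
      rw [hbuf, Function.update_self] at hs
      obtain rfl := Option.some.inj hs
      rintro ⟨rv', l, h'⟩
      cases h'
      exact h2 k hk hd _ hm ⟨_, _, rfl⟩
    · rw [hbuf, Function.update_of_ne hkm] at hs
      exact h2 k hk hd s hs
  rcases h3 with ⟨j, ad', rfl, hj, had⟩ | ⟨hj, hma⟩
  · refine .inl ⟨j, ad', rfl, ?_, had⟩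
    by_cases hjm : j = m
    · subst hjm
      rw [hj] at hm
      cases hm
      cases hw
      simp [hbuf]
    · rw [hbuf, Function.update_of_ne hjm, hj]
  · refine .inr ⟨fun j hdj => ?_, by rw [hmem, hma]⟩
    rw [hbuf, Function.update_of_ne, hj j hdj]
    rintro rfl
    simp [hj j hdj] at hm

/-- The store at `m` gets its address, and causes no hazard. -/
theorem Config.LoadOK.update_storeAddr {m : ℕ} {rv : Operand R V L} {rvs : List (Operand R V L)}
    {b : V} {lab : L} (hm : C.buf m = some (.store rv (.args rvs)))
    (hmem : C'.mem = C.mem)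
    (hbuf : C'.buf = Function.update C.buf m (some (.store rv (.resolved b lab))))
    {i : ℕ} {r : R} {v : LVal V L} {dep : WithBot ℕ} {a n : V}
    (hz : ¬ (TransInstr.loadVal (Op := Op) r v dep a n).Hazard m b n) (h : C.LoadOK i v dep a) :
    C'.LoadOK i v dep a := by
  -- The two ways of avoiding a hazard are the two facts that `LoadOK` needs about the new address:
  -- a store newer than the source writes elsewhere, and the source itself writes to `a`.
  have hz1 : a = b → ¬ dep < (m : WithBot ℕ) := fun h1 h2 => hz ⟨r, v, dep, a, rfl, .inl ⟨h1, h2⟩⟩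
  have hz2 : dep = (m : WithBot ℕ) → b = a := fun h1 => by
    by_contra h2
    exact hz ⟨r, v, dep, a, rfl, .inr ⟨h1, fun h => h2 h.symm⟩⟩
  obtain ⟨h1, h2, h3⟩ := h
  refine ⟨h1, fun k hk hd s hs => ?_, ?_⟩
  · by_cases hkm : k = m
    · subst hkm
      rw [hbuf, Function.update_self] at hs
      obtain rfl := Option.some.inj hs
      rintro ⟨rv', l, h'⟩
      cases h'
      exact hz1 rfl hd
    · rw [hbuf, Function.update_of_ne hkm] at hs
      exact h2 k hk hd s hs
  rcases h3 with ⟨j, ad', rfl, hj, had⟩ | ⟨hj, hma⟩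
  · by_cases hjm : j = m
    · subst hjm
      rw [hj] at hm
      cases hm
      refine .inl ⟨j, _, rfl, by rw [hbuf, Function.update_self], ?_⟩
      rintro a' l ⟨⟩
      exact hz2 rfl
    · exact .inl ⟨j, ad', rfl, by rw [hbuf, Function.update_of_ne hjm, hj], had⟩
  · refine .inr ⟨fun j hdj => ?_, by rw [hmem, hma]⟩
    rw [hbuf, Function.update_of_ne, hj j hdj]
    rintro rfl
    simp [hj j hdj] at hm

end

theorem Entry.next {A : Arch R V L Op} {C : Config R V L Op} {i : ℕ} {n : V}
    {M : Micro R V L Op} {t : TransInstr R V L Op} {l l' : Loc V}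
    (he : Entry A C i n M t l') (h : M.next = some l) : l' = l := by
  cases he <;> simp_all [Micro.next]

/-! ### Locations -/

section
variable [Lattice L] [OrderBot L] {A : Arch R V L Op}

theorem MicroAt.inj {μ : V → Option (Cell R V L Op)} {l : Loc V} {M M' : Micro R V L Op}
    (h : MicroAt A μ l M) (h' : MicroAt A μ l M') : M = M' := by
  obtain ⟨I, hI, hM⟩ := h
  obtain ⟨I', hI', hM'⟩ := h'
  simp_all

/-- Storing data at the address of no instruction does not change the code. -/
theorem microAt_update [DecidableEq V] {μ : V → Option (Cell R V L Op)} {a : V} {v : LVal V L}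
    (ha : ∀ I, μ a ≠ some (.instr I)) {l : Loc V} {M : Micro R V L Op} (h : MicroAt A μ l M) :
    MicroAt A (Function.update μ a (some (.data v))) l M := by
  obtain ⟨I, hI, hM⟩ := h
  refine ⟨I, ?_, hM⟩
  rw [Function.update_of_ne, hI]
  rintro rfl
  exact ha I hI

/-- The location of a single entry at the start of a block, except for a call or a return, is
followed by the start of a block. -/
theorem Entry.next_zero {C : Config R V L Op} {i : ℕ} {l l' : Loc V} {M : Micro R V L Op}
    {t : TransInstr R V L Op} (hM : MicroAt A C.mem l M) (h : Entry A C i l.1 M t l')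
    (h0 : l.2 = 0) (hc : t ≠ .call) (hr : t ≠ .ret) : l'.2 = 0 := by
  obtain ⟨I, -, hI⟩ := hM
  rw [h0] at hI
  cases h <;> cases I <;> simp_all [Instr.micro] <;> simp [← hI]

/-- A location inside a block is preceded by the previous location of the block. -/
theorem Entry.of_next_succ {C : Config R V L Op} {i : ℕ} {l : Loc V} {n : V} {k : ℕ}
    {M : Micro R V L Op} {t : TransInstr R V L Op} (hM : MicroAt A C.mem l M)
    (h : Entry A C i l.1 M t (n, k + 1)) : l = (n, k) := by
  -- Jumps lead to offset 0, so a location with positive offset is reached only through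
  -- `Micro.next`.
  have hn : M.next = some (n, k + 1) := by
    generalize hl : (n, k + 1) = l' at h
    cases h <;> first | rfl | simp at hl
  obtain ⟨I, -, hI⟩ := hM
  obtain ⟨m, o⟩ := l
  cases I <;> rcases o with _ | _ | _ | _ | o <;>
    simp only [Instr.micro, Option.some.injEq, reduceCtorEq] at hI <;> subst hI <;>
    simp_all [Micro.next]

/-- Micro-operations read the temporary register only at the end of the block of a return. -/
theorem MicroAt.reads_rret {C : Config R V L Op} (hC : C.NeverReads A.rret) {l : Loc V}
    {M : Micro R V L Op} (hM : MicroAt A C.mem l M) (h : .reg A.rret ∈ M.operands) :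
    A.rret = A.rsp ∨ (l.2 = 3 ∧ C.mem l.1 = some (.instr .ret)) := by
  obtain ⟨I, hI, hM⟩ := hM
  have := hC _ _ hI
  obtain ⟨m, o⟩ := l
  cases I <;> rcases o with _ | _ | _ | _ | o <;>
    simp only [Instr.micro, Option.some.injEq, reduceCtorEq] at hM <;> subst hM <;>
    simp_all [Instr.operands, Micro.operands]

end

/-! ### Building and cutting buffers -/

section
variable [Lattice L] [OrderBot L] {A : Arch R V L Op} {C C' : Config R V L Op} {lo hi : ℕ}
  {g : ℕ → Loc V}

theorem Core.get (h : Core A C lo hi g) {i : ℕ} {t : TransInstr R V L Op}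
    (hi' : C.buf i = some t) :
    lo ≤ i ∧ i < hi ∧ ∃ M, MicroAt A C.mem (g i) M ∧ Entry A C i (g i).1 M t (g (i + 1)) := by
  have h1 : lo ≤ i := by
    by_contra hlt
    simp [h.lt_lo i (by omega)] at hi'
  have h2 : i < hi := by
    by_contra hlt
    simp [h.ge_hi i (by omega)] at hi'
  obtain ⟨M, t', hM, ht', he⟩ := h.entry i h1 h2
  obtain rfl : t' = t := by simpa [ht'] using hi'
  exact ⟨h1, h2, M, hM, he⟩

/-- Entries look only at smaller indices, so an initial segment of a correct buffer is correct. -/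
theorem Core.trunc (h : Core A C lo hi g) {c : ℕ} (hlc : lo ≤ c) (hch : c ≤ hi)
    (hreg : C'.reg = C.reg) (hmem : C'.mem = C.mem) (hbuf : C'.buf = below C.buf c) :
    Core A C' lo c g where
  pos := h.pos
  le := hlc
  lt_lo i hi := by simp [hbuf, below, h.lt_lo i hi]
  ge_hi i hi := by simp [hbuf, below]; omega
  entry i h1 h2 := by
    obtain ⟨M, t, hM, ht, he⟩ := h.entry i h1 (by omega)
    refine ⟨M, t, hmem ▸ hM, by simp [hbuf, below, h2, ht], he.congr hreg hmem fun j hj => ?_⟩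
    simp only [hbuf, below, if_pos (show j < c by omega)]

theorem Core.push (h : Core A C lo hi g) {M : Micro R V L Op} {t : TransInstr R V L Op}
    {l : Loc V} (hM : MicroAt A C.mem (g hi) M) (he : Entry A C hi (g hi).1 M t l)
    (hreg : C'.reg = C.reg) (hmem : C'.mem = C.mem)
    (hbuf : C'.buf = Function.update C.buf hi (some t)) :
    Core A C' lo (hi + 1) (Function.update g (hi + 1) l) where
  pos := h.pos
  le := by have := h.le; omega
  lt_lo i hi := by
    have := h.le
    rw [hbuf, Function.update_of_ne (by omega), h.lt_lo i hi]
  ge_hi i hi := by rw [hbuf, Function.update_of_ne (by omega), h.ge_hi i (by omega)]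
  entry i h1 h2 := by
    have hb : ∀ j < i, C'.buf j = C.buf j := fun j hj => by
      rw [hbuf, Function.update_of_ne (by omega)]
    rw [Function.update_of_ne (by omega : i ≠ hi + 1)]
    by_cases hih : i = hi
    · subst hih
      exact ⟨M, t, hmem ▸ hM, by simp [hbuf], by simpa using he.congr hreg hmem hb⟩
    · obtain ⟨M, t, hM, ht, he⟩ := h.entry i h1 (by omega)
      rw [Function.update_of_ne (by omega)]
      refine ⟨M, t, hmem ▸ hM, ?_, he.congr hreg hmem hb⟩
      rw [hbuf, Function.update_of_ne hih, ht]

/-- Keeping the destination and any value already available protects the younger entries that have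
read this one, including those that have used a guessed load value. -/
theorem Core.refine (h : Core A C lo hi g) {m : ℕ} {M : Micro R V L Op}
    {t t' : TransInstr R V L Op} (hm : C.buf m = some t)
    (hM : MicroAt A C.mem (g m) M) (he : Entry A C m (g m).1 M t' (g (m + 1)))
    (hdest : t'.dest = t.dest) (hval : ∀ v, t.value = some v → t'.value = some v)
    (hreg : C'.reg = C.reg) (hmem : C'.mem = C.mem)
    (hbuf : C'.buf = Function.update C.buf m (some t'))
    (hl : ∀ i r v dep a n, m < i → C.buf i = some (.loadVal r v dep a n) → C.LoadOK i v dep a →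
      C'.LoadOK i v dep a) :
    Core A C' lo hi g := by
  obtain ⟨h1, h2, -⟩ := h.get hm
  have hb : ∀ j, j ≠ m → C'.buf j = C.buf j := fun j hj => by
    rw [hbuf, Function.update_of_ne hj]
  refine ⟨h.pos, h.le, fun i hi => ?_, fun i hi => ?_, fun i hi hi' => ?_⟩
  · rw [hb i (by omega), h.lt_lo i hi]
  · rw [hb i (by omega), h.ge_hi i hi]
  by_cases him : i = m
  · subst him
    exact ⟨M, t', hmem ▸ hM, by simp [hbuf], he.congr hreg hmem fun j hj => hb j (by omega)⟩
  obtain ⟨M', s, hM', hs, he'⟩ := h.entry i hi hi'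
  refine ⟨M', s, hmem ▸ hM', by rw [hb i him, hs], he'.mono (fun r _ v => ?_) ?_⟩
  · exact Config.resolveReg_refine hreg hbuf hm hdest hval i r v
  rintro r v dep a n rfl hok
  by_cases hlt : i < m
  · exact hok.congr hmem fun j hj => hb j (by omega)
  · exact hl i r v dep a n (by omega) hs hok

/-- Rolling back a load reaches the start of the block fetched at its program point. -/
theorem Core.fetchStart (h : Core A C lo hi g) (h0 : (g lo).2 = 0) {k : ℕ}
    {t : TransInstr R V L Op} {M : Micro R V L Op} (hk : C.buf k = some t)
    (hM : MicroAt A C.mem (g k) M) (hl : ∃ r rvs l, M = .load r rvs l) :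
    lo ≤ C.fetchStart k ∧ C.fetchStart k ≤ k ∧ g (C.fetchStart k) = ((g k).1, 0) := by
  obtain ⟨r, rvs, l, rfl⟩ := hl
  obtain ⟨h1, h2, -⟩ := h.get hk
  -- Indices start at 1, so `k - 1` is a genuine predecessor and not a truncated difference.
  have hpos := h.pos
  unfold Config.fetchStart
  obtain ⟨I, hI, hIM⟩ := hM
  -- A load is an instruction by itself or the second entry of a return.
  have hcases : ((g k).2 = 0) ∨ ((g k).2 = 1 ∧ I = .ret) := by
    revert hIM
    generalize (g k).2 = o
    intro hIM
    cases I <;> rcases o with _ | _ | _ | _ | o <;> simp_all [Instr.micro]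
  rcases hcases with h' | ⟨h', rfl⟩
  · have hne : C.buf (k - 1) ≠ some .ret := by
      intro hr
      obtain ⟨-, -, M', hM', he'⟩ := h.get hr
      rw [show k - 1 + 1 = k by omega] at he'
      obtain ⟨I', -, hI'⟩ := hM'
      revert he' hI'
      generalize (g (k - 1)).2 = o
      intro he' hI'
      generalize hgk : g k = gk at he'
      cases he'
      rw [hgk] at h'
      cases I' <;> rcases o with _ | _ | _ | _ | o <;> simp_all [Instr.micro]
      simp [← hI'] at h'
    simp only [if_neg hne]
    exact ⟨h1, le_rfl, Prod.ext rfl h'⟩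
  -- The path starts at offset 0, so the marker of this return is still in the buffer.
  · have hlk : lo ≠ k := by
      rintro rfl
      omega
    obtain ⟨M', t', hM', ht', he'⟩ := h.entry (k - 1) (by omega) (by omega)
    rw [show k - 1 + 1 = k by omega, show g k = ((g k).1, 0 + 1) from Prod.ext rfl h'] at he'
    have hg := he'.of_next_succ hM'
    have hMr : M' = .ret ((g k).1, 1) := by
      refine hM'.inj ⟨.ret, ?_, ?_⟩
      · rw [hg]
        exact hI
      · simp [hg, Instr.micro]
    subst hMr
    have hr : C.buf (k - 1) = some .ret := by
      cases he'
      exact ht'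
    simp only [if_pos hr]
    exact ⟨by omega, by omega, hg⟩

/-- At the start of a block, the value of the temporary register does not matter. -/
theorem Core.change_rret (h : Core A C lo hi g) (h0 : (g lo).2 = 0) (hC : C.NeverReads A.rret)
    (hbuf : C'.buf = C.buf) (hmem : C'.mem = C.mem)
    (hreg : ∀ r, (r = A.rret → A.rret = A.rsp) → C'.reg r = C.reg r) : Core A C' lo hi g := by
  refine ⟨h.pos, h.le, hbuf ▸ h.lt_lo, hbuf ▸ h.ge_hi, fun i hli hih => ?_⟩
  obtain ⟨M, t, hM, ht, he⟩ := h.entry i hli hih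
  refine ⟨M, t, hmem ▸ hM, by rw [hbuf, ht], he.mono (fun r hr v hv => ?_)
    fun _ _ _ _ _ _ hok => hok.congr hmem fun j _ => by rw [hbuf]⟩
  by_cases hrr : r = A.rret → A.rret = A.rsp
  · rw [Config.resolveReg_congr_reg hbuf (hreg r hrr), hv]
  push Not at hrr
  obtain ⟨rfl, hne⟩ := hrr
  obtain h' | ⟨h3, hret⟩ := hM.reads_rret hC hr
  · exact absurd h' hne
  -- Since the path starts at offset 0, a positive offset always has its predecessor in the buffer.
  have pred : ∀ j k, lo ≤ j → j < hi → g j = ((g i).1, k + 1) →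
      lo < j ∧ ∃ M t, MicroAt A C.mem (g (j - 1)) M ∧ C.buf (j - 1) = some t ∧
        Entry A C (j - 1) (g (j - 1)).1 M t (g j) ∧ g (j - 1) = ((g i).1, k) := by
    intro j k h1 h2 hg
    have hlj : lo ≠ j := by
      rintro rfl
      simp [hg] at h0
    obtain ⟨M, t, hM, ht, he⟩ := h.entry (j - 1) (by omega) (by omega)
    rw [show j - 1 + 1 = j by omega] at he
    exact ⟨by omega, M, t, hM, ht, he, (hg ▸ he).of_next_succ hM⟩
  -- The only reader is the jump at offset 3. Two steps back, at offset 1, stands the load into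
  -- `rret`, which hides the register map from it.
  obtain ⟨hl1, -, -, -, -, -, hg1⟩ := pred i 2 hli hih (Prod.ext rfl h3)
  obtain ⟨hl2, M', t', hM', ht', he', hg2⟩ := pred (i - 1) 1 (by omega) (by omega) hg1
  have hM2 : M' = .load A.rret [.reg A.rsp] ((g i).1, 2) := by
    refine hM'.inj ⟨.ret, ?_, ?_⟩
    · rw [hg2]
      exact hret
    · simp [hg2, Instr.micro]
  subst hM2
  have hd : t'.dest = some A.rret := by
    generalize g (i - 1) = l at he'
    cases he' <;> rfl
  rw [Config.resolveReg_of_dest hbuf (by omega : i - 1 - 1 < i) ht' hd, hv]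

/-- Nonemptiness matters: the fresh index of an empty buffer is 1, whatever `hi` is. -/
theorem Core.fresh_eq (h : Core A C lo hi g) (hlt : lo < hi) :
    C.fresh = hi := by
  have hm : maxIdx C.buf = hi - 1 := by
    refine IsGreatest.csSup_eq ⟨?_, fun i hi' => ?_⟩
    · obtain ⟨-, t, -, ht, -⟩ := h.entry (hi - 1) (by omega) (by omega)
      simp [ht]
    · by_contra hlt
      exact hi' (h.ge_hi i (by omega))
  rw [Config.fresh, hm]
  omega

theorem Core.minIdx_eq (h : Core A C lo hi g) {i : ℕ}
    {t : TransInstr R V L Op} (hmin : minIdx C.buf = i) (hi' : C.buf i = some t) : i = lo := by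
  obtain ⟨h1, h2, -⟩ := h.get hi'
  rw [← hmin]
  refine IsLeast.csInf_eq ⟨?_, fun j hj => ?_⟩
  · obtain ⟨-, t, -, ht, -⟩ := h.entry lo le_rfl (by omega)
    simp [ht]
  · by_contra hlt
    exact hj (h.lt_lo j (by omega))

end

/-! ### The sequential machine -/

/-- A state of the sequential machine. -/
structure SeqState (R V L Op : Type*) where
  reg : R → Option (LVal V L)
  mem : V → Option (Cell R V L Op)
  loc : Loc V

/-- The value of an operand under a register map. -/
def Operand.eval (ρ : R → Option (LVal V L)) : Operand R V L → Option (LVal V L)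
  | .reg r => ρ r
  | .val v => some v

/-- The values of operands under a register map. -/
def evalArgs (ρ : R → Option (LVal V L)) (rvs : List (Operand R V L)) : Option (List (LVal V L)) :=
  rvs.mapM (Operand.eval ρ)

/-- Sequential execution of a micro-operation. -/
def Micro.step [DecidableEq R] [DecidableEq V] (A : Arch R V L Op) (s : SeqState R V L Op) :
    Micro R V L Op → Option (SeqState R V L Op)
  | .op o r rvs l => ((evalArgs s.reg rvs).bind (A.evalOp o)).map fun v =>
      ⟨Function.update s.reg r (some v), s.mem, l⟩
  | .br o rvs nT nF => ((evalArgs s.reg rvs).bind (A.evalCond o)).map fun b =>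
      ⟨s.reg, s.mem, (if b then nT else nF, 0)⟩
  | .load r rvs l => ((evalArgs s.reg rvs).bind A.addr).bind fun a =>
      match s.mem a with
      | some (.data v) => some ⟨Function.update s.reg r (some v), s.mem, l⟩
      | _ => none
  -- No check for a data address is made here: the sequential machine only has to reproduce commits,
  -- and `Commits` contains that check.
  | .store rv rvs l => ((evalArgs s.reg rvs).bind A.addr).bind fun a => (rv.eval s.reg).map fun v =>
      ⟨s.reg, Function.update s.mem a (some (.data v)), l⟩
  | .jmpi rvs => ((evalArgs s.reg rvs).bind A.addr).map fun n => ⟨s.reg, s.mem, (n, 0)⟩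
  | .call l => some ⟨s.reg, s.mem, l⟩
  | .ret l => some ⟨s.reg, s.mem, l⟩
  | .fence l => some ⟨s.reg, s.mem, l⟩

/-! ### Committing the oldest entry -/

theorem Config.Resolves.evalArgs {C : Config R V L Op} {i : ℕ} (hlt : ∀ j < i, C.buf j = none)
    {rvs : List (Operand R V L)} {vs : List (LVal V L)} (h : C.Resolves i rvs vs) :
    evalArgs C.reg rvs = some vs := by
  have hres : C.resolve i = Operand.eval C.reg := by
    funext rv
    cases rv with
    | reg r => exact Config.resolveReg_eq_reg hlt r
    | val v => rfl
  unfold Config.Resolves at h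
  rw [hres] at h
  unfold SpecMachine.evalArgs
  induction rvs generalizing vs with
  | nil =>
    cases vs with
    | nil => rfl
    | cons w vs => simp at h
  | cons a rvs ih =>
    cases vs with
    | nil => simp at h
    | cons w vs =>
      simp only [List.map_cons, List.cons.injEq] at h
      simp [List.mapM_cons, h.1, ih h.2]

section
variable [DecidableEq R] [DecidableEq V]

/-- Committing the entry `t` results in the register map `ρ` and the memory `μ`. -/
inductive Commits (C : Config R V L Op) : TransInstr R V L Op → (R → Option (LVal V L)) →
    (V → Option (Cell R V L Op)) → Prop
  | val (r v) : Commits C (.val r v) (Function.update C.reg r (some v)) C.mem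
  | loadVal (r v dep a n) :
      Commits C (.loadVal r v dep a n) (Function.update C.reg r (some v)) C.mem
  | jump (n) : Commits C (.jump n) C.reg C.mem
  | call : Commits C .call C.reg C.mem
  | ret : Commits C .ret C.reg C.mem
  | fence : Commits C .fence C.reg C.mem
  | store (v a l) (hd : C.IsDataAddr a) : Commits C (.store (.val v) (.resolved a l)) C.reg
      (Function.update C.mem a (some (.data v)))

theorem Commits.reg_eq {C : Config R V L Op} {t : TransInstr R V L Op}
    {ρ : R → Option (LVal V L)} {μ : V → Option (Cell R V L Op)} (h : Commits C t ρ μ) (r : R) :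
    (t.dest = some r → ρ r = t.value) ∧ (t.dest ≠ some r → ρ r = C.reg r) := by
  cases h <;> simp +contextual [TransInstr.dest, TransInstr.value, eq_comm]

/-- A commit writes only data, so it creates no new instruction. -/
theorem Commits.neverReads {C C' : Config R V L Op} {t : TransInstr R V L Op}
    {ρ : R → Option (LVal V L)} (h : Commits C t ρ C'.mem) {r : R}
    (hC : C.NeverReads r) : C'.NeverReads r := by
  intro n I hI
  refine hC n I ?_
  generalize C'.mem = μ at h hI
  cases h with
  | store v a l hd =>
    rwa [Function.update_of_ne] at hI
    rintro rfl
    simp at hI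
  | _ => exact hI

end

/-- If the retired store is the source of the load, its address is `a` and the memory takes over as
source. If the source is another buffered store, it is untouched. If the load already agrees with
memory, the retired store is newer than its source, so `LoadOK` forbids it to write to `a`. -/
theorem Config.LoadOK.commit_store [DecidableEq V] {C C' : Config R V L Op} {m i : ℕ}
    {w : LVal V L} {b : V} {lab : L} (hm : C.buf m = some (.store (.val w) (.resolved b lab)))
    (hdom : ∀ j, m < j → j < i → C.buf j ≠ none) (hmi : m < i)
    (hmem : C'.mem = Function.update C.mem b (some (.data w)))
    (hbuf : C'.buf = Function.update C.buf m none) {v : LVal V L} {dep : WithBot ℕ} {a : V}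
    (h : C.LoadOK i v dep a) : C'.LoadOK i v dep a := by
  obtain ⟨h1, h2, h3⟩ := h
  refine ⟨h1, fun k hk hd s hs => ?_, ?_⟩
  · by_cases hkm : k = m
    · simp [hbuf, hkm] at hs
    · rw [hbuf, Function.update_of_ne hkm] at hs
      exact h2 k hk hd s hs
  rcases h3 with ⟨j, ad, rfl, hj, had⟩ | ⟨hj, hma⟩
  · by_cases hjm : j = m
    · subst hjm
      rw [hj] at hm
      cases hm
      refine .inr ⟨fun j' hj' => ?_, ?_⟩
      · obtain rfl : j = j' := by exact_mod_cast hj'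
        simp [hbuf]
      · simp [hmem, had b lab rfl]
    · exact .inl ⟨j, ad, rfl, by rw [hbuf, Function.update_of_ne hjm, hj], had⟩
  -- Here `dep` is `⊥` or an index absent from the buffer. As there are no gaps between `m` and `i`,
  -- such an index lies below `m`.
  · have hdm : dep < (m : WithBot ℕ) := by
      induction dep with
      | bot => exact WithBot.bot_lt_coe m
      | coe j =>
        have hj' := hj j rfl
        have hji : j < i := WithBot.coe_lt_coe.mp h1
        have hjm : j ≠ m := by
          rintro rfl
          simp [hj'] at hm
        have : j < m := by
          by_contra hlt
          exact hdom j (by omega) hji hj'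
        exact WithBot.coe_lt_coe.mpr this
    have hab : a ≠ b := by
      rintro rfl
      exact h2 m hmi hdm _ hm ⟨_, _, rfl⟩
    refine .inr ⟨fun j hdj => ?_, by rw [hmem, Function.update_of_ne hab, hma]⟩
    rw [hbuf, Function.update_apply, hj j hdj, ite_self]

/-! ### Sequential execution, and its agreement with commits. -/

variable [DecidableEq R] [DecidableEq V] [Lattice L] [OrderBot L] (A : Arch R V L Op)

/-- Sequential execution of the micro-operation at the current location. -/
def SeqState.microStep (s : SeqState R V L Op) : Option (SeqState R V L Op) :=
  match s.mem s.loc.1 with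
  | some (.instr I) => (I.micro A s.loc.1 s.loc.2).bind (Micro.step A s)
  | _ => none

/-- Sequential execution of an instruction; a return does not commit the temporary register. -/
def SeqState.step (s : SeqState R V L Op) : Option (SeqState R V L Op) :=
  match s.mem s.loc.1 with
  | some (.instr (.call _ _)) =>
      ((s.microStep A).bind (·.microStep A)).bind (·.microStep A)
  | some (.instr .ret) =>
      ((((s.microStep A).bind (·.microStep A)).bind (·.microStep A)).bind (·.microStep A)).map
        fun t => { t with reg := Function.update s.reg A.rsp (t.reg A.rsp) }
  | _ => s.microStep A

/-- Sequential execution of `N` instructions. -/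
def SeqState.steps (s : SeqState R V L Op) : ℕ → Option (SeqState R V L Op)
  | 0 => some s
  | N + 1 => (s.steps N).bind (·.step A)

variable {A}


theorem Commits.microAt {C : Config R V L Op} {t : TransInstr R V L Op}
    {ρ : R → Option (LVal V L)} {μ : V → Option (Cell R V L Op)} (h : Commits C t ρ μ) {l : Loc V}
    {M : Micro R V L Op} (hM : MicroAt A C.mem l M) : MicroAt A μ l M := by
  cases h with
  | store v a l hd => exact microAt_update hd hM
  | _ => exact hM

/-- What the head supplied to younger entries through the buffer, they now find in the register map
or in memory. -/
theorem Core.commit {C C' : Config R V L Op} {lo hi : ℕ} {g : ℕ → Loc V} (h : Core A C lo hi g)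
    {t : TransInstr R V L Op} (ht : C.buf lo = some t) (hc : Commits C t C'.reg C'.mem)
    (hbuf : C'.buf = Function.update C.buf lo none) : Core A C' (lo + 1) hi g := by
  obtain ⟨-, hlt, -⟩ := h.get ht
  refine ⟨by omega, hlt, fun i hi => ?_, fun i hi => ?_, fun i hi hi' => ?_⟩
  · rw [hbuf, Function.update_apply]
    split_ifs with hil
    · rfl
    · exact h.lt_lo i (by omega)
  · rw [hbuf, Function.update_of_ne (by omega), h.ge_hi i hi]
  obtain ⟨M, s, hM, hs, he⟩ := h.entry i (by omega) hi'
  refine ⟨M, s, hc.microAt hM, by rw [hbuf, Function.update_of_ne (by omega), hs],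
    he.mono (fun r _ v hv => ?_) ?_⟩
  · rw [Config.resolveReg_commit h.lt_lo ht hbuf hc.reg_eq i hi, hv]
  rintro r v dep a n - hok
  have hdom : ∀ j, lo < j → j < i → C.buf j ≠ none := fun j hj hj' => by
    obtain ⟨-, u, -, hu, -⟩ := h.entry j (by omega) (by omega)
    simp [hu]
  generalize hμ : C'.mem = μ at hc
  generalize C'.reg = ρ at hc
  cases hc with
  | store w b lab hd => exact hok.commit_store ht hdom hi hμ hbuf
  | _ => exact hok.update_of_not_store ht (by simp) (by simp) hμ hbuf

/-- The head has no older entries, so its operands were read from the register map. Only fully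
resolved forms commit, so no prediction is left in it. -/
theorem Core.microStep {C : Config R V L Op} {lo hi : ℕ} {g : ℕ → Loc V} (h : Core A C lo hi g)
    {t : TransInstr R V L Op} (ht : C.buf lo = some t) {ρ : R → Option (LVal V L)}
    {μ : V → Option (Cell R V L Op)} (hc : Commits C t ρ μ) :
    SeqState.microStep A ⟨C.reg, C.mem, g lo⟩ = some ⟨ρ, μ, g (lo + 1)⟩ := by
  obtain ⟨-, -, M, ⟨I, hI, hM⟩, he⟩ := h.get ht
  simp only [SeqState.microStep, hI, hM, Option.bind_some]
  generalize g (lo + 1) = l at he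
  cases he with
  | val o r rvs l vs v hr hv =>
    cases hc
    simp [Micro.step, hr.evalArgs h.lt_lo, hv]
  | brJump o rvs nT nF vs b n₀ hr hb hn =>
    cases hc
    simp [Micro.step, hr.evalArgs h.lt_lo, hb, hn]
  | loadVal r rvs l vs v dep a hr ha hl =>
    cases hc
    -- A source still in the buffer would lie below `lo`, where there is nothing.
    have hm : C.mem a = some (.data v) := by
      rcases hl.2.2 with ⟨j, ad, rfl, hj, -⟩ | ⟨-, hm⟩
      · have := hl.1
        rw [h.lt_lo j (by exact_mod_cast this)] at hj
        cases hj
      · exact hm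
    simp [Micro.step, hr.evalArgs h.lt_lo, ha, hm]
  | store rv rvs l rv' ad hv hd =>
    cases hc with
    | store v a lab hda =>
    rcases hd with hd | ⟨vs, a, lab, hd, hr, ha⟩
    · cases hd
    cases hd
    have hv' : rv.eval C.reg = some v := by
      rcases hv with rfl | ⟨w, hw, hv⟩
      · rfl
      · cases hw
        cases rv with
        | reg r => rw [← hv]; exact (Config.resolveReg_eq_reg h.lt_lo r).symm
        | val x => exact hv
    simp [Micro.step, hr.evalArgs h.lt_lo, ha, hv']
  | jmpiJump rvs vs n₀ hr ha =>
    cases hc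
    simp [Micro.step, hr.evalArgs h.lt_lo, ha]
  | call => cases hc; rfl
  | ret => cases hc; rfl
  | fence => cases hc; rfl
  | _ => cases hc

/-! ### The invariant of the speculative machine -/

/-- The committed part of `C` is the result of executing `N` instructions sequentially from `s`,
and the buffer is a correct path from there to the program point of `C`. -/
def Inv (A : Arch R V L Op) (s : SeqState R V L Op) (N : ℕ) (C : Config R V L Op) : Prop :=
  ∃ lo hi g, Core A C lo hi g ∧ (g lo).2 = 0 ∧ g hi = (C.pc, 0) ∧ C.NeverReads A.rret ∧
    s.steps A N = some ⟨C.reg, C.mem, g lo⟩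

variable {s : SeqState R V L Op} {N : ℕ} {C C' : Config R V L Op}

theorem Inv.initial (hC : C.IsInitial) (hret : C.NeverReads A.rret) :
    Inv A ⟨C.reg, C.mem, (C.pc, 0)⟩ 0 C :=
  ⟨1, 1, fun _ => (C.pc, 0), ⟨le_rfl, le_rfl, fun i _ => hC i, fun i _ => hC i,
    fun i h h' => by omega⟩, rfl, rfl, hret, rfl⟩

/-- The path can be indexed such that it ends at the fresh index. -/
theorem Inv.fresh (h : Inv A s N C) : ∃ lo g, Core A C lo C.fresh g ∧ (g lo).2 = 0 ∧
    g C.fresh = (C.pc, 0) ∧ C.NeverReads A.rret ∧ s.steps A N = some ⟨C.reg, C.mem, g lo⟩ := by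
  obtain ⟨lo, hi, g, hc, h0, hpc, hr, hs⟩ := h
  rcases hc.le.lt_or_eq with hlt | rfl
  · rw [hc.fresh_eq hlt]
    exact ⟨lo, g, hc, h0, hpc, hr, hs⟩
  -- An empty buffer restarts its numbering at 1, so the empty path is moved there.
  · have hb : ∀ i, C.buf i = none := fun i => by
      rcases lt_or_ge i lo with hi | hi
      · exact hc.lt_lo i hi
      · exact hc.ge_hi i hi
    have hf : C.fresh = 1 := by simp [Config.fresh, maxIdx, hb]
    rw [hf]
    exact ⟨1, fun _ => g lo, ⟨le_rfl, le_rfl, fun i _ => hb i, fun i _ => hb i,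
      fun i h h' => by omega⟩, h0, hpc, hr, hs⟩

/-! ### Fetch -/

/-- A guessed target becomes the location after the new entry, so the path stays consistent whatever
the directive guesses. -/
theorem Inv.fetch (h : Inv A s N C) {I : Instr R V L Op} (hI : C.mem C.pc = some (.instr I))
    {M : Micro R V L Op} (hM : I.micro A C.pc 0 = some M) {t : TransInstr R V L Op}
    (he : ∀ i, Entry A C i C.pc M t (C'.pc, 0)) (hreg : C'.reg = C.reg) (hmem : C'.mem = C.mem)
    (hbuf : C'.buf = Function.update C.buf C.fresh (some t)) : Inv A s N C' := by
  obtain ⟨lo, g, hc, h0, hpc, hr, hs⟩ := h.fresh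
  have hlo : lo ≠ C.fresh + 1 := by
    have := hc.le
    omega
  refine ⟨lo, C.fresh + 1, _, hc.push (M := M) (t := t) (l := (C'.pc, 0)) ?_ ?_ hreg hmem hbuf,
    ?_, ?_, ?_, ?_⟩
  · rw [hpc]
    exact ⟨I, hI, hM⟩
  · rw [hpc]
    exact he _
  · rwa [Function.update_of_ne hlo]
  · simp
  · unfold Config.NeverReads
    rwa [hmem]
  · rw [Function.update_of_ne hlo, hreg, hmem, hs]

/-- The block is pushed entry by entry. Its partial buffers end inside a block, so only `Core` is
available for them. -/
theorem Inv.fetch_call (h : Inv A s N C) {nf nret : V}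
    (hI : C.mem C.pc = some (.instr (.call nf nret))) (hpc' : C'.pc = nf)
    (hreg : C'.reg = C.reg) (hmem : C'.mem = C.mem)
    (hbuf : C'.buf = Function.update (Function.update (Function.update C.buf
      C.fresh (some .call))
      (C.fresh + 1) (some (.op A.succ A.rsp [.reg A.rsp])))
      (C.fresh + 2) (some (.store (.val ⟨nret, ⊥⟩) (.args [.reg A.rsp])))) : Inv A s N C' := by
  obtain ⟨lo, g, hc, h0, hpc, hr, hs⟩ := h.fresh
  have hle := hc.le
  generalize C.fresh = f at *
  have c1 := hc.push (C' := { C with buf := Function.update C.buf f (some .call) })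
    (M := .call (C.pc, 1)) (l := (C.pc, 1)) ⟨_, by rw [hpc]; exact hI, by rw [hpc]; rfl⟩
    (.call _) rfl rfl rfl
  have c2 := c1.push (C' := { C with
      buf := Function.update
        (Function.update C.buf f (some .call)) (f + 1) (some (.op A.succ A.rsp [.reg A.rsp])) })
    (M := .op A.succ A.rsp [.reg A.rsp] (C.pc, 2)) (l := (C.pc, 2))
    ⟨_, by rw [Function.update_self]; exact hI, by rw [Function.update_self]; rfl⟩
    (.op _ _ _ _) rfl rfl rfl
  have c3 := c2.push (C' := C')
    (M := .store (.val ⟨nret, ⊥⟩) [.reg A.rsp] (nf, 0)) (l := (nf, 0))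
    ⟨_, by rw [Function.update_self]; exact hI, by rw [Function.update_self]; rfl⟩
    (.store _ _ _ _ _ (.inl rfl) (.inl rfl)) hreg hmem hbuf
  have hg : Function.update (Function.update (Function.update g (f + 1) (C.pc, 1))
      (f + 1 + 1) (C.pc, 2)) (f + 1 + 1 + 1) (nf, 0) lo = g lo := by
    rw [Function.update_of_ne (by omega), Function.update_of_ne (by omega),
      Function.update_of_ne (by omega)]
  refine ⟨lo, _, _, c3, by rwa [hg], by rw [Function.update_self, hpc'], ?_,
    by rw [hg, hreg, hmem, hs]⟩
  unfold Config.NeverReads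
  rwa [hmem]

theorem Inv.fetch_ret (h : Inv A s N C) {n' : V}
    (hI : C.mem C.pc = some (.instr .ret)) (hpc' : C'.pc = n')
    (hreg : C'.reg = C.reg) (hmem : C'.mem = C.mem)
    (hbuf : C'.buf = Function.update (Function.update (Function.update (Function.update C.buf
      C.fresh (some .ret))
      (C.fresh + 1) (some (.load A.rret [.reg A.rsp] C.pc)))
      (C.fresh + 2) (some (.op A.pred A.rsp [.reg A.rsp])))
      (C.fresh + 3) (some (.jmpi [.reg A.rret] n'))) : Inv A s N C' := by
  obtain ⟨lo, g, hc, h0, hpc, hr, hs⟩ := h.fresh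
  have hle := hc.le
  generalize C.fresh = f at *
  have c1 := hc.push (C' := { C with buf := Function.update C.buf f (some .ret) })
    (M := .ret (C.pc, 1)) (l := (C.pc, 1)) ⟨_, by rw [hpc]; exact hI, by rw [hpc]; rfl⟩
    (.ret _) rfl rfl rfl
  have c2 := c1.push (C' := { C with
      buf := Function.update
        (Function.update C.buf f (some .ret)) (f + 1) (some (.load A.rret [.reg A.rsp] C.pc)) })
    (M := .load A.rret [.reg A.rsp] (C.pc, 2)) (l := (C.pc, 2))
    ⟨_, by rw [Function.update_self]; exact hI, by rw [Function.update_self]; rfl⟩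
    (by rw [Function.update_self]; exact .load _ _ _) rfl rfl rfl
  have c3 := c2.push (C' := { C with
      buf := Function.update (Function.update
        (Function.update C.buf f (some .ret))
        (f + 1) (some (.load A.rret [.reg A.rsp] C.pc)))
        (f + 2) (some (.op A.pred A.rsp [.reg A.rsp])) })
    (M := .op A.pred A.rsp [.reg A.rsp] (C.pc, 3)) (l := (C.pc, 3))
    ⟨_, by rw [Function.update_self]; exact hI, by rw [Function.update_self]; rfl⟩
    (.op _ _ _ _) rfl rfl rfl
  have c4 := c3.push (C' := C')
    (M := .jmpi [.reg A.rret]) (l := (n', 0))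
    ⟨_, by rw [Function.update_self]; exact hI, by rw [Function.update_self]; rfl⟩
    (.jmpi _ _) hreg hmem hbuf
  have hg : Function.update (Function.update (Function.update (Function.update g
      (f + 1) (C.pc, 1)) (f + 1 + 1) (C.pc, 2)) (f + 1 + 1 + 1) (C.pc, 3))
      (f + 1 + 1 + 1 + 1) (n', 0) lo = g lo := by
    rw [Function.update_of_ne (by omega), Function.update_of_ne (by omega),
      Function.update_of_ne (by omega), Function.update_of_ne (by omega)]
  refine ⟨lo, _, _, c4, by rwa [hg], by rw [Function.update_self, hpc'], ?_,
    by rw [hg, hreg, hmem, hs]⟩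
  unfold Config.NeverReads
  rwa [hmem]

/-! ### Execute -/

theorem Inv.execute (h : Inv A s N C) {m : ℕ} {t t' : TransInstr R V L Op}
    (hm : C.buf m = some t) (hbuf : C'.buf = Function.update C.buf m (some t'))
    (he : ∀ n M l, Entry A C m n M t l → Entry A C m n M t' l)
    (hdest : t'.dest = t.dest) (hval : ∀ v, t.value = some v → t'.value = some v)
    (hreg : C'.reg = C.reg) (hmem : C'.mem = C.mem) (hpc : C'.pc = C.pc)
    (hl : ∀ i r v dep a n, m < i → C.buf i = some (.loadVal r v dep a n) → C.LoadOK i v dep a →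
      C'.LoadOK i v dep a) : Inv A s N C' := by
  obtain ⟨lo, hi, g, hc, h0, hpc', hr, hs⟩ := h
  obtain ⟨-, -, M, hM, hent⟩ := hc.get hm
  refine ⟨lo, hi, g, hc.refine hm hM (he _ _ _ hent) hdest hval hreg hmem hbuf hl, h0,
    by rw [hpc, hpc'], ?_, by rw [hreg, hmem, hs]⟩
  unfold Config.NeverReads
  rwa [hmem]

theorem Inv.execute_of_not_store (h : Inv A s N C) {m : ℕ} {t t' : TransInstr R V L Op}
    (hm : C.buf m = some t) (hbuf : C'.buf = Function.update C.buf m (some t'))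
    (he : ∀ n M l, Entry A C m n M t l → Entry A C m n M t' l)
    (hdest : t'.dest = t.dest) (hval : ∀ v, t.value = some v → t'.value = some v)
    (ht : ∀ rv ad, t ≠ .store rv ad) (ht' : ∀ rv ad, t' ≠ .store rv ad)
    (hreg : C'.reg = C.reg) (hmem : C'.mem = C.mem) (hpc : C'.pc = C.pc) : Inv A s N C' :=
  h.execute hm hbuf he hdest hval hreg hmem hpc fun _ _ _ _ _ _ _ _ hok =>
    hok.update_of_not_store hm ht (fun rv ad h => ht' rv ad (Option.some.inj h)) hmem hbuf

/-- A mispredicted jump at index `i` is resolved. -/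
theorem Inv.redirect (h : Inv A s N C) {i : ℕ} {t t' : TransInstr R V L Op}
    (hi' : C.buf i = some t)
    (hbuf : C'.buf = Function.update (below C.buf i) i (some t'))
    (he : ∀ n M l, Entry A C i n M t l → Entry A C i n M t' (C'.pc, 0))
    (hreg : C'.reg = C.reg) (hmem : C'.mem = C.mem) : Inv A s N C' := by
  obtain ⟨lo, hi, g, hc, h0, hpc', hr, hs⟩ := h
  obtain ⟨h1, h2, M, hM, hent⟩ := hc.get hi'
  -- Cutting at `i` and pushing the resolved jump replaces the wrong continuation by the correct
  -- target.
  have c1 := hc.trunc (C' := { C with buf := below C.buf i }) h1 h2.le rfl rfl rfl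
  have c2 := c1.push (C' := C') (M := M) (t := t') (l := (C'.pc, 0)) hM
    ((he _ _ _ hent).congr rfl rfl fun j hj => by simp [below, hj]) hreg hmem hbuf
  have hg : Function.update g (i + 1) (C'.pc, 0) lo = g lo := Function.update_of_ne (by omega) _ _
  refine ⟨lo, _, _, c2, by rwa [hg], by simp, ?_, by rw [hg, hreg, hmem, hs]⟩
  unfold Config.NeverReads
  rwa [hmem]

/-- A load at index `k` is rolled back. -/
theorem Inv.rollback (h : Inv A s N C) {k : ℕ} {t : TransInstr R V L Op} (hk : C.buf k = some t)
    (ht : (∃ r rvs v j, t = .loadGuess r rvs v j C'.pc) ∨ ∃ r v dep a, t = .loadVal r v dep a C'.pc)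
    (hreg : C'.reg = C.reg) (hmem : C'.mem = C.mem)
    (hbuf : C'.buf = below C.buf (C.fetchStart k)) : Inv A s N C' := by
  obtain ⟨lo, hi, g, hc, h0, hpc', hr, hs⟩ := h
  obtain ⟨h1, h2, M, hM, hent⟩ := hc.get hk
  have hload : (∃ r rvs l, M = .load r rvs l) ∧ (g k).1 = C'.pc := by
    rcases ht with ⟨r, rvs, v, j, rfl⟩ | ⟨r, v, dep, a, rfl⟩
    all_goals
      generalize hn : (g k).1 = n at hent
      generalize hp : C'.pc = p at hent
      cases hent
      exact ⟨⟨_, _, _, rfl⟩, rfl⟩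
  obtain ⟨h3, h4, h5⟩ := hc.fetchStart h0 hk hM hload.1
  refine ⟨lo, _, g, hc.trunc h3 (by omega) hreg hmem hbuf, h0, by rw [h5, hload.2], ?_,
    by rw [hreg, hmem, hs]⟩
  unfold Config.NeverReads
  rwa [hmem]

/-- The address of a store is resolved and conflicts with a later load. -/
theorem Inv.storeAddr_hazard (h : Inv A s N C) {i k : ℕ} {rv : Operand R V L}
    {rvs : List (Operand R V L)} {vs : List (LVal V L)} {a n : V} {t : TransInstr R V L Op} {lab : L}
    (hi : C.buf i = some (.store rv (.args rvs))) (hr : C.Resolves i rvs vs)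
    (ha : A.addr vs = some a) (hik : i < k) (hk : C.buf k = some t) (hz : t.Hazard i a n)
    (hmin : ∀ k' t' n', i < k' → k' < k → C.buf k' = some t' → ¬ t'.Hazard i a n')
    (hreg : C'.reg = C.reg) (hmem : C'.mem = C.mem) (hpc : C'.pc = n)
    (hbuf : C'.buf = Function.update (below C.buf (C.fetchStart k)) i
      (some (.store rv (.resolved a lab)))) : Inv A s N C' := by
  -- The store survives the cut: were it at `k - 1`, that entry would not be a return marker, and
  -- the cut would be at `k`.
  have hf : i < C.fetchStart k ∧ C.fetchStart k ≤ k := by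
    unfold Config.fetchStart
    split_ifs with hret
    · have : i ≠ k - 1 := by
        rintro rfl
        simp [hi] at hret
      omega
    · omega
  obtain ⟨r, v, dep, a', rfl, -⟩ := hz
  have hb : ∀ j < C.fetchStart k, below C.buf (C.fetchStart k) j = C.buf j := fun j hj => by
    simp [below, hj]
  -- The step is split into a rollback of the load at `k` and a resolution of the address in the
  -- shorter buffer. There no hazard is left, because `k` was the first one.
  obtain ⟨C₁, h1, e1, e2, e3, e4⟩ : ∃ C₁, Inv A s N C₁ ∧ C₁.reg = C.reg ∧ C₁.mem = C.mem ∧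
      C₁.pc = n ∧ C₁.buf = below C.buf (C.fetchStart k) :=
    ⟨{ C with pc := n, buf := below C.buf (C.fetchStart k) },
      h.rollback hk (.inr ⟨r, v, dep, a', rfl⟩) rfl rfl rfl, rfl, rfl, rfl, rfl⟩
  rw [← e1] at hreg
  rw [← e2] at hmem
  rw [← e4] at hb hbuf
  have hi1 : C₁.buf i = some (.store rv (.args rvs)) := by rw [hb i hf.1, hi]
  refine h1.execute (t' := .store rv (.resolved a lab)) hi1 hbuf (fun n' M l he => ?_) rfl
    (by simp [TransInstr.value]) hreg hmem (hpc.trans e3.symm)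
    fun i' r' v' dep' b n' hii hi' hok => ?_
  · have hr' : C₁.Resolves i rvs vs := hr.mono fun r _ v hv => by
      rw [← hv]
      exact Config.resolveReg_congr e1 (fun j hj => hb j (by omega)) r
    cases he with
    | store rv₀ rvs₀ l _ _ hv had =>
      refine .store _ _ _ _ _ hv (.inr ⟨vs, a, lab, rfl, ?_, ha⟩)
      rcases had with had | ⟨_, _, _, had, -⟩
      · cases had
        exact hr'
      · cases had
  · have hlt : i' < C.fetchStart k := by
      by_contra hge
      simp [e4, below, hge] at hi'
    exact hok.update_storeAddr hi1 hmem hbuf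
      (hmin i' (.loadVal r' v' dep' b n') n' hii (by omega) (by rw [← hi', hb i' hlt]))

/-! ### Retire -/

/-- The head is at offset 0 and is not a marker, so it is a whole block, for which `SeqState.step`
and `SeqState.microStep` agree. -/
theorem Inv.retire (h : Inv A s N C) {i : ℕ} {t : TransInstr R V L Op}
    (hmin : minIdx C.buf = i) (ht : C.buf i = some t) (hcall : t ≠ .call) (hret : t ≠ .ret)
    (hc : Commits C t C'.reg C'.mem) (hpc : C'.pc = C.pc)
    (hbuf : C'.buf = Function.update C.buf i none) : Inv A s (N + 1) C' := by
  obtain ⟨lo, hi, g, hcore, h0, hpc', hr, hs⟩ := h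
  obtain rfl := hcore.minIdx_eq hmin ht
  obtain ⟨-, -, M, hM, he⟩ := hcore.get ht
  refine ⟨i + 1, hi, g, hcore.commit ht hc hbuf, he.next_zero hM h0 hcall hret, by rw [hpc, hpc'],
    hc.neverReads hr, ?_⟩
  rw [SeqState.steps, hs, Option.bind_some, ← hcore.microStep ht hc]
  obtain ⟨I, hI, hIM⟩ := hM
  rw [h0] at hIM
  cases I with
  | call nf nret =>
    cases hIM
    generalize g (i + 1) = l at he
    cases he
    exact absurd rfl hcall
  | ret =>
    cases hIM
    generalize g (i + 1) = l at he
    cases he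
    exact absurd rfl hret
  | _ => simp only [SeqState.step, hI]

theorem Inv.retire_call (h : Inv A s N C) {i : ℕ} {vsp vret : LVal V L} {a : V} {lab : L}
    (hmin : minIdx C.buf = i) (hi0 : C.buf i = some .call)
    (hi1 : C.buf (i + 1) = some (.val A.rsp vsp))
    (hi2 : C.buf (i + 2) = some (.store (.val vret) (.resolved a lab))) (hd : C.IsDataAddr a)
    (hreg : C'.reg = Function.update C.reg A.rsp (some vsp))
    (hmem : C'.mem = Function.update C.mem a (some (.data vret))) (hpc : C'.pc = C.pc)
    (hbuf : C'.buf = above C.buf (i + 2)) : Inv A s (N + 1) C' := by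
  obtain ⟨lo, hi, g, c0, h0, hpc', hr, hs⟩ := h
  obtain rfl := c0.minIdx_eq hmin hi0
  obtain ⟨-, -, M, hM, he⟩ := c0.get hi0
  obtain ⟨-, -, M1, hM1, he1⟩ := c0.get hi1
  obtain ⟨-, -, M2, hM2, he2⟩ := c0.get hi2
  obtain ⟨n, hg0⟩ : ∃ n, g i = (n, 0) := ⟨(g i).1, Prod.ext rfl h0⟩
  obtain ⟨I, hI, hIM⟩ := hM
  have hI' : ∃ nf nret, I = .call nf nret := by
    rw [hg0] at hIM
    generalize g (i + 1) = l at he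
    cases he
    cases I <;> simp [Instr.micro] at hIM
    exact ⟨_, _, rfl⟩
  obtain ⟨nf, nret, rfl⟩ := hI'
  rw [hg0] at hI hIM
  have hg1 : g (i + 1) = (n, 1) := he.next (by cases hIM; rfl)
  have hg2 : g (i + 2) = (n, 2) := he1.next (by
    rw [hM1.inj ⟨_, by rw [hg1]; exact hI, by rw [hg1]; rfl⟩]; rfl)
  have hg3 : g (i + 3) = (nf, 0) := he2.next (by
    rw [hM2.inj ⟨_, by rw [hg2]; exact hI, by rw [hg2]; rfl⟩]; rfl)
  have k1 : Commits C .call C.reg C.mem := .call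
  have c1 := c0.commit (C' := { C with buf := Function.update C.buf i none }) hi0 k1 rfl
  have s1 := c0.microStep hi0 k1
  have k2 : Commits { C with buf := Function.update C.buf i none } (.val A.rsp vsp)
    (Function.update C.reg A.rsp (some vsp)) C.mem := .val _ _
  have b1 : Function.update C.buf i none (i + 1) = some (.val A.rsp vsp) := by simp [hi1]
  have c2 := c1.commit (C' := { C with
    reg := Function.update C.reg A.rsp (some vsp)
    buf := Function.update (Function.update C.buf i none) (i + 1) none }) b1 k2 rfl
  have s2 := c1.microStep b1 k2
  have k3 : Commits { C with
    reg := Function.update C.reg A.rsp (some vsp)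
    buf := Function.update (Function.update C.buf i none) (i + 1) none }
    (.store (.val vret) (.resolved a lab)) C'.reg C'.mem := by
    rw [hreg, hmem]
    exact .store _ _ _ hd
  have b2 : Function.update (Function.update C.buf i none) (i + 1) none (i + 1 + 1) =
      some (.store (.val vret) (.resolved a lab)) := by
    rw [Function.update_of_ne (by omega), Function.update_of_ne (by omega)]
    exact hi2
  -- Nothing lies below the marker, so deleting the three entries one by one gives `above C.buf (i +
  -- 2)`.
  have c3 := c2.commit (C' := C') b2 k3 (by
    rw [hbuf]
    funext j
    simp only [above, Function.update_apply]
    split_ifs <;> first | rfl | omega | exact (c0.lt_lo j (by omega)).symm)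
  have s3 := c2.microStep b2 k3
  refine ⟨_, hi, g, c3, congrArg Prod.snd hg3, by rw [hpc, hpc'], k3.neverReads hr, ?_⟩
  rw [SeqState.steps, hs, Option.bind_some]
  have hIg : C.mem (g i).1 = some (.instr (.call nf nret)) := by rw [hg0]; exact hI
  simp only [SeqState.step, hIg, s1, Option.bind_some, s2, s3]

/-- The four entries are committed in turn, including the write to `rret` that the jump needs, and
this write is then taken back. -/
theorem Inv.retire_ret (h : Inv A s N C) {i : ℕ} {v₁ v₂ : LVal V L} {dep : WithBot ℕ} {a n₁ n' : V}
    (hmin : minIdx C.buf = i) (hi0 : C.buf i = some .ret)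
    (hi1 : C.buf (i + 1) = some (.loadVal A.rret v₁ dep a n₁))
    (hi2 : C.buf (i + 2) = some (.val A.rsp v₂)) (hi3 : C.buf (i + 3) = some (.jump n'))
    (hreg : C'.reg = Function.update C.reg A.rsp (some v₂)) (hmem : C'.mem = C.mem)
    (hpc : C'.pc = C.pc) (hbuf : C'.buf = above C.buf (i + 3)) : Inv A s (N + 1) C' := by
  obtain ⟨lo, hi, g, c0, h0, hpc', hr, hs⟩ := h
  obtain rfl := c0.minIdx_eq hmin hi0
  obtain ⟨-, -, M, hM, he⟩ := c0.get hi0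
  obtain ⟨-, -, M3, hM3, he3⟩ := c0.get hi3
  obtain ⟨n, hg0⟩ : ∃ n, g i = (n, 0) := ⟨(g i).1, Prod.ext rfl h0⟩
  obtain ⟨I, hI, hIM⟩ := hM
  have hI' : I = .ret := by
    rw [hg0] at hIM
    generalize g (i + 1) = l at he
    cases he
    cases I <;> simp [Instr.micro] at hIM
    rfl
  subst hI'
  have hg4 : (g (i + 4)).2 = 0 := by
    change Entry A C (i + 3) (g (i + 3)).1 M3 (.jump n') (g (i + 4)) at he3
    generalize g (i + 4) = l at he3
    cases he3 <;> rfl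
  have k1 : Commits C .ret C.reg C.mem := .ret
  have c1 := c0.commit (C' := { C with buf := Function.update C.buf i none }) hi0 k1 rfl
  have s1 := c0.microStep hi0 k1
  have k2 : Commits { C with buf := Function.update C.buf i none } (.loadVal A.rret v₁ dep a n₁)
    (Function.update C.reg A.rret (some v₁)) C.mem := .loadVal _ _ _ _ _
  have b1 : Function.update C.buf i none (i + 1) = some (.loadVal A.rret v₁ dep a n₁) := by
    simp [hi1]
  have c2 := c1.commit (C' := { C with
    reg := Function.update C.reg A.rret (some v₁)
    buf := Function.update (Function.update C.buf i none) (i + 1) none }) b1 k2 rfl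
  have s2 := c1.microStep b1 k2
  have k3 : Commits { C with
    reg := Function.update C.reg A.rret (some v₁)
    buf := Function.update (Function.update C.buf i none) (i + 1) none } (.val A.rsp v₂)
    (Function.update (Function.update C.reg A.rret (some v₁)) A.rsp (some v₂)) C.mem := .val _ _
  have b2 : Function.update (Function.update C.buf i none) (i + 1) none (i + 1 + 1) =
      some (.val A.rsp v₂) := by
    rw [Function.update_of_ne (by omega), Function.update_of_ne (by omega)]
    exact hi2
  have c3 := c2.commit (C' := { C with
    reg := Function.update (Function.update C.reg A.rret (some v₁)) A.rsp (some v₂)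
    buf := Function.update (Function.update (Function.update C.buf i none) (i + 1) none)
      (i + 1 + 1) none }) b2 k3 rfl
  have s3 := c2.microStep b2 k3
  have k4 : Commits { C with
    reg := Function.update (Function.update C.reg A.rret (some v₁)) A.rsp (some v₂)
    buf := Function.update (Function.update (Function.update C.buf i none) (i + 1) none)
      (i + 1 + 1) none } (.jump n')
    (Function.update (Function.update C.reg A.rret (some v₁)) A.rsp (some v₂)) C.mem := .jump _
  have b3 : Function.update (Function.update (Function.update C.buf i none) (i + 1) none)
      (i + 1 + 1) none (i + 1 + 1 + 1) = some (.jump n') := by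
    rw [Function.update_of_ne (by omega), Function.update_of_ne (by omega),
      Function.update_of_ne (by omega)]
    exact hi3
  have c4 := c3.commit (C' := { C with
    reg := Function.update (Function.update C.reg A.rret (some v₁)) A.rsp (some v₂)
    buf := above C.buf (i + 3) }) b3 k4 (by
      funext j
      simp only [above, Function.update_apply]
      split_ifs <;> first | rfl | omega | exact (c0.lt_lo j (by omega)).symm)
  have s4 := c3.microStep b3 k4
  -- If `rret` and `rsp` coincide, the write to `rret` has already been overwritten. Otherwise
  -- `rret` is the only register on which the two maps can differ.
  have c5 := c4.change_rret (C' := C') hg4 hr hbuf hmem fun r hrr => by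
    rw [hreg]
    simp only [Function.update_apply]
    split_ifs with h1 h2
    · rfl
    · exact absurd (h2.trans (hrr h2)) h1
    · rfl
  have hr' : C'.NeverReads A.rret := by
    unfold Config.NeverReads
    rwa [hmem]
  refine ⟨_, hi, g, c5, hg4, by rw [hpc, hpc'], hr', ?_⟩
  rw [SeqState.steps, hs, Option.bind_some]
  simp only [SeqState.step, hI, s1, Option.bind_some, s2, s3, s4, Option.map_some, hreg, hmem,
    Function.update_self]

/-! ### Consistency -/

/-- Only retirement advances the sequential machine; all other steps change the path but not the
committed part. -/
theorem Inv.of_step {C C' : ExtConfig R V L Op} {d : Directive V} {o : List (Obs V L)}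
    (hstep : Step A C d o C') (h : Inv A s N C.toConfig) :
    Inv A s (N + if d.isRetire then 1 else 0) C'.toConfig := by
  cases hstep with
  | opFetch o r rvs n' hI => exact h.fetch hI rfl (fun i => .op _ _ _ _) rfl rfl rfl
  | loadFetch r rvs n' hI => exact h.fetch hI rfl (fun i => .load _ _ _) rfl rfl rfl
  | storeFetch rv rvs n' hI =>
    exact h.fetch hI rfl (fun i => .store _ _ _ _ _ (.inl rfl) (.inl rfl)) rfl rfl rfl
  | fenceFetch n' hI => exact h.fetch hI rfl (fun i => .fence _) rfl rfl rfl
  | brFetch b o rvs nT nF hI => exact h.fetch hI rfl (fun i => .br _ _ _ _ _) rfl rfl rfl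
  | jmpiFetch n' rvs hI => exact h.fetch hI rfl (fun i => .jmpi _ _) rfl rfl rfl
  | callFetch nf nret hI => exact h.fetch_call hI rfl rfl rfl rfl
  | retFetchRsb n' hI hσ => exact h.fetch_ret hI rfl rfl rfl rfl
  | retFetchRsbEmpty n' hI hσ => exact h.fetch_ret hI rfl rfl rfl rfl
  | opExecute i o r rvs vs v hi hf hr hv =>
    refine h.execute_of_not_store hi rfl (fun n M l he => ?_) rfl (by simp [TransInstr.value])
      (by simp) (by simp) rfl rfl rfl
    cases he
    exact .val _ _ _ _ _ _ hr hv
  | brExecuteCorrect i o rvs n₀ nT nF vs b hi hf hr hb hn =>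
    refine h.execute_of_not_store hi rfl (fun n M l he => ?_) rfl (by simp [TransInstr.value])
      (by simp) (by simp) rfl rfl rfl
    cases he
    exact .brJump _ _ _ _ _ _ _ hr hb hn
  | brExecuteIncorrect i o rvs n₀ nT nF vs b n' hi hf hr hb hn' hn =>
    refine h.redirect hi rfl (fun n M l he => ?_) rfl rfl
    cases he
    exact .brJump _ _ _ _ _ _ _ hr hb hn'
  | jmpiExecuteCorrect i rvs n₀ vs hi hf hr ha =>
    refine h.execute_of_not_store hi rfl (fun n M l he => ?_) rfl (by simp [TransInstr.value])
      (by simp) (by simp) rfl rfl rfl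
    cases he
    exact .jmpiJump _ _ _ hr ha
  | jmpiExecuteIncorrect i rvs n₀ vs n' hi hf hr ha hn =>
    refine h.redirect hi rfl (fun n M l he => ?_) rfl rfl
    cases he
    exact .jmpiJump _ _ _ hr ha
  | loadExecuteNodep i r rvs n vs a v hi hf hr ha hs hm =>
    refine h.execute_of_not_store hi rfl (fun n M l he => ?_) rfl (by simp [TransInstr.value])
      (by simp) (by simp) rfl rfl rfl
    cases he
    exact .loadVal _ _ _ _ _ _ _ hr ha
      ⟨WithBot.bot_lt_coe i, fun k hk _ => hs k hk, .inr ⟨fun j hj => by simp at hj, hm⟩⟩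
  | loadExecuteForward i r rvs n vs a j v l hi hf hr ha hji hj hmax =>
    refine h.execute_of_not_store hi rfl (fun n M l he => ?_) rfl (by simp [TransInstr.value])
      (by simp) (by simp) rfl rfl rfl
    cases he
    exact .loadVal _ _ _ _ _ _ _ hr ha ⟨by exact_mod_cast hji,
      fun k hk hjk => hmax k (by exact_mod_cast hjk) hk,
      .inl ⟨j, _, rfl, hj, fun a' l h' => by cases h'; rfl⟩⟩
  | loadExecuteGuess i r rvs n j v ad hi hf hji hj =>
    refine h.execute_of_not_store hi rfl (fun n M l he => ?_) rfl (by simp [TransInstr.value])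
      (by simp) (by simp) rfl rfl rfl
    cases he
    exact .loadGuess _ _ _ _ _ hji
  | loadExecuteAddrOk i r rvs v j n vs a ad hi hf hr ha hj had hmax =>
    refine h.execute_of_not_store hi rfl (fun n M l he => ?_) rfl (by simp [TransInstr.value])
      (by simp) (by simp) rfl rfl rfl
    cases he with
    -- The rule that checks the address does not state `j < i`; the guessed entry has kept it.
    | loadGuess _ _ _ _ _ hji =>
    exact .loadVal _ _ _ _ _ _ _ hr ha ⟨by exact_mod_cast hji,
      fun k hk hjk => hmax k (by exact_mod_cast hjk) hk, .inl ⟨j, _, rfl, hj, had⟩⟩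
  | loadExecuteAddrHazard i r rvs v j n vs a hi hf hr ha hz =>
    exact h.rollback hi (.inl ⟨_, _, _, _, rfl⟩) rfl rfl rfl
  | loadExecuteMemMatch i r rvs v j n vs a hi hf hr ha hj hs hm =>
    refine h.execute_of_not_store hi rfl (fun n M l he => ?_) rfl (by simp [TransInstr.value])
      (by simp) (by simp) rfl rfl rfl
    cases he
    exact .loadVal _ _ _ _ _ _ _ hr ha
      ⟨WithBot.bot_lt_coe i, fun k hk _ => hs k hk, .inr ⟨fun j hj => by simp at hj, hm⟩⟩
  | loadExecuteMemHazard i r rvs v j n vs a v' hi hf hr ha hj hs hm hv =>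
    exact h.rollback hi (.inl ⟨_, _, _, _, rfl⟩) rfl rfl rfl
  | storeExecuteValue i rv ad v hi hf hv =>
    refine h.execute hi rfl (fun n M l he => ?_) rfl (by simp [TransInstr.value]) rfl rfl rfl
      fun _ _ _ _ _ _ _ _ hok => by
        refine hok.update_storeValue hi hv ?_ ?_ <;> rfl
    cases he with
    | store rv₀ rvs₀ l _ _ hv₀ had =>
      refine .store _ _ _ _ _ (.inr ⟨v, rfl, ?_⟩) had
      -- The directive may be repeated: a value already resolved resolves to itself.
      rcases hv₀ with rfl | ⟨w, rfl, hw⟩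
      · exact hv
      · cases hv
        exact hw
  | storeExecuteAddrOk i rv rvs vs a hi hf hr ha hz =>
    refine h.execute hi rfl (fun n M l he => ?_) rfl (by simp [TransInstr.value]) rfl rfl rfl
      fun k _ _ _ _ n hik hk hok => by
        refine hok.update_storeAddr (lab := joinLab vs) hi ?_ ?_ (hz k _ n hik hk) <;> rfl
    cases he with
    | store rv₀ rvs₀ l _ _ hv₀ had =>
      refine .store _ _ _ _ _ hv₀ (.inr ⟨vs, a, _, rfl, ?_, ha⟩)
      rcases had with had | ⟨_, _, _, had, -⟩
      · cases had
        exact hr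
      · cases had
  | storeExecuteAddrHazard i rv rvs vs a k t n hi hf hr ha hik hk hz hmin =>
    exact h.storeAddr_hazard hi hr ha hik hk hz hmin rfl rfl rfl rfl
  | valRetire i r v hmin hi =>
    exact h.retire hmin hi (by simp) (by simp) (.val _ _) rfl rfl
  | loadRetire i r v dep a n hmin hi =>
    exact h.retire hmin hi (by simp) (by simp) (.loadVal _ _ _ _ _) rfl rfl
  | jumpRetire i n₀ hmin hi =>
    exact h.retire hmin hi (by simp) (by simp) (.jump _) rfl rfl
  | fenceRetire i hmin hi =>
    exact h.retire hmin hi (by simp) (by simp) .fence rfl rfl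
  | storeRetire i v a l hmin hi hd =>
    exact h.retire hmin hi (by simp) (by simp) (.store _ _ _ hd) rfl rfl
  | callRetire i vsp vret a l hmin hi hi1 hi2 hd =>
    exact h.retire_call hmin hi hi1 hi2 hd rfl rfl rfl rfl
  | retRetire i v₁ dep a n v₂ n' hmin hi hi1 hi2 hi3 =>
    exact h.retire_ret hmin hi hi1 hi2 hi3 rfl rfl rfl rfl

theorem Inv.of_steps {C C' : ExtConfig R V L Op} {D : List (Directive V)} {O : List (Obs V L)}
    (hsteps : Steps A C D O C') (h : Inv A s N C.toConfig) :
    Inv A s (N + D.countP Directive.isRetire) C'.toConfig := by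
  induction hsteps generalizing N with
  | nil C => exact h
  | cons hstep _ ih =>
    have := ih (h.of_step hstep)
    rwa [List.countP_cons, Nat.add_comm (List.countP _ _), ← Nat.add_assoc]

theorem Inv.pc_eq (h : Inv A s N C) (hC : C.IsTerminal) :
    s.steps A N = some ⟨C.reg, C.mem, (C.pc, 0)⟩ := by
  obtain ⟨lo, hi, g, hc, -, hpc, -, hs⟩ := h
  rcases hc.le.lt_or_eq with hlt | rfl
  · obtain ⟨-, t, -, ht, -⟩ := hc.entry lo le_rfl hlt
    simp [hC lo] at ht
  · rw [hs, hpc]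

end SpecMachine

theorem mainTheorem5 {R V L Op : Type*} [DecidableEq R] [DecidableEq V] [Lattice L] [OrderBot L]
    (A : SpecMachine.Arch R V L Op) (C C₁ C₂ : SpecMachine.ExtConfig R V L Op)
    (hC : C.IsInitial) (hret : C.NeverReads A.rret)
    (N : ℕ) (D₁ D₂ : List (SpecMachine.Directive V)) (O₁ O₂ : List (SpecMachine.Obs V L))
    (h₁ : SpecMachine.BigStep A N C D₁ O₁ C₁) (h₂ : SpecMachine.BigStep A N C D₂ O₂ C₂) :
    C₁.Approx C₂.toConfig ∧
      (C₁.IsTerminal → C₂.IsTerminal → C₁.toConfig = C₂.toConfig) := by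
  have i₁ := (SpecMachine.Inv.initial hC hret).of_steps h₁.1
  have i₂ := (SpecMachine.Inv.initial hC hret).of_steps h₂.1
  rw [h₁.2] at i₁
  rw [h₂.2] at i₂
  refine ⟨?_, fun t₁ t₂ => ?_⟩
  · obtain ⟨_, _, _, -, -, -, -, hs₁⟩ := i₁
    obtain ⟨_, _, _, -, -, -, -, hs₂⟩ := i₂
    -- Determinism enters here: both committed states are the value of `SeqState.steps` at the same
    -- `N`.
    have heq := Option.some.inj (hs₁.symm.trans hs₂)
    exact ⟨congrArg SpecMachine.SeqState.mem heq, congrArg SpecMachine.SeqState.reg heq⟩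
  · have heq := Option.some.inj ((i₁.pc_eq t₁).symm.trans (i₂.pc_eq t₂))
    have hbuf : C₁.buf = C₂.buf := funext fun i => (t₁ i).trans (t₂ i).symm
    obtain ⟨⟨ρ₁, μ₁, n₁, b₁⟩, σ₁⟩ := C₁
    obtain ⟨⟨ρ₂, μ₂, n₂, b₂⟩, σ₂⟩ := C₂
    simp_all
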